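/- For integers $1\le p\le n-1$ let $\mathrm{St}(n,p)=\{X\in\mathbb{R}^{n\times p} : X^\top X=I_p\}$ be the Stiefel manifold, with tangent spaces $\mathrm{T}_X\mathrm{St}(n,p)=\{\xi\in\mathbb{R}^{n\times p} : X^\top\xi+\xi^\top X=0\}$. For $\beta>0$ endow it with the Riemannian metric \[ g_X(\xi,\eta)=\beta\,\mathrm{tr}\big((X^\top\xi)^\top X^\top\eta\big)+\mathrm{tr}\big(\xi^\top(I_n-XX^\top)\eta\big),\qquad \xi,\eta\in\mathrm{T}_X\mathrm{St}(n,p); \] equivalently, $g_X(\xi_{\mathrm a},\xi_{\mathrm b})=\beta\,\mathrm{tr}(A_{\mathrm a}^\top A_{\mathrm b})+\mathrm{tr}(H_{\mathrm a}^\top H_{\mathrm b})$ for $\xi_i=XA_i+X_\perp H_i$, where $[X\ X_\perp]$ is orthogonal. The metric with $\beta=\tfrac12$ is the canonical metric and the metric with $\beta=1$ is the Euclidean metric. Let $d$ be the Riemannian distance. For a unit tangent vector $\xi$ at $X$ let $\gamma_\xi$ be the geodesic with $\gamma_\xi(0)=X$ and $\gamma_\xi'(0)=\xi$, and let $t_{\mathrm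 c}(\xi)=\sup\{t>0 : d(X,\gamma_\xi(t))=t\}$ be its cut time. The injectivity radius $\mathrm{inj}_{\mathrm{St}(n,p)}$ is the infimum of $t_{\mathrm c}(\xi)$ over all $X\in\mathrm{St}(n,p)$ and all unit tangent vectors $\xi$ at $X$. Then the following hold. 1. The equation $\frac{\sin t}{t}+\cos t=0$ has a smallest positive solution $t^{\mathrm r}$, and $t^{\mathrm r}\sqrt2\approx 0.91326189159122\,\pi$ (the error of the coefficient of $\pi$ is at most $5\cdot10^{-15}$). For all $n,p$ with $2\le p\le n-2$, in the canonical metric, \[ \mathrm{inj}_{\mathrm{St}(n,p)}\le t^{\mathrm r}\sqrt2 . \] 2. For all $n,p$ with $2\le p\le n-2$, in the Euclidean metric, $\mathrm{inj}_{\mathrm{St}(n,p)}\le\pi$. 3. For all $n\ge2$ and $p=n-1$, $\mathrm{inj}_{\mathrm{St}(n,n-1)}=\pi$ in the canonical metric and $\mathrm{inj}_{\mathrm{St}(n,n-1)}\le\pi$ in the Euclidean metric. 4. For all $n\ge2$ and $p=1$, $\mathrm{inj}_{\mathrm{St}(n,1)}=\pi$ in the metric with any parameter $\beta>0$. -/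

import Mathlib

open scoped Matrix ContDiff ENNReal

noncomputable section

namespace Stiefel

/- The ambient vector space of real matrices, normed by the Frobenius norm.  The norm is only
used to speak of smoothness and of derivatives, for which all norms are equivalent. -/
attribute [local instance] Matrix.frobeniusNormedAddCommGroup Matrix.frobeniusNormedSpace

/-- The Stiefel manifold `St(n,p)` of orthonormal `p`-frames in `ℝⁿ`. -/
def manifold (n p : ℕ) : Set (Matrix (Fin n) (Fin p) ℝ) :=
  {X | Xᵀ * X = 1}

/-- The tangent space of `St(n,p)` at `X`. -/
def tangentSpace {n p : ℕ} (X : Matrix (Fin n) (Fin p) ℝ) :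
    Set (Matrix (Fin n) (Fin p) ℝ) :=
  {ξ | Xᵀ * ξ + ξᵀ * X = 0}

/-- The metric with parameter `β`:
`g_X(ξ, η) = β tr((Xᵀ ξ)ᵀ (Xᵀ η)) + tr(ξᵀ (I - X Xᵀ) η)`.
`β = 1/2` is the canonical metric and `β = 1` is the Euclidean metric.  For tangent vectors
`ξ = X A + X⊥ H` and `η = X A' + X⊥ H'` this is `β tr(Aᵀ A') + tr(Hᵀ H')`, see `metric_blocks`.
The same formula is defined for all matrices, and for `X` near `St(n,p)` and `β > 0` it is an inner
product on the ambient space; `IsGeodesic` uses this extension. -/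
def metric {n p : ℕ} (β : ℝ) (X ξ η : Matrix (Fin n) (Fin p) ℝ) : ℝ :=
  β * ((Xᵀ * ξ)ᵀ * (Xᵀ * η)).trace + (ξᵀ * (1 - X * Xᵀ) * η).trace

/-- The metric in terms of the decomposition of tangent vectors by an orthogonal matrix `[X Y]`. -/
theorem metric_blocks {n p m : ℕ} (β : ℝ) (X : Matrix (Fin n) (Fin p) ℝ)
    (Y : Matrix (Fin n) (Fin m) ℝ) (hX : Xᵀ * X = 1) (hY : Yᵀ * Y = 1) (hXY : Xᵀ * Y = 0)
    (A A' : Matrix (Fin p) (Fin p) ℝ) (H H' : Matrix (Fin m) (Fin p) ℝ) :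
    metric β X (X * A + Y * H) (X * A' + Y * H') =
      β * (Aᵀ * A').trace + (Hᵀ * H').trace := by
  have e : ∀ (B : Matrix (Fin p) (Fin p) ℝ) (K : Matrix (Fin m) (Fin p) ℝ),
      Xᵀ * (X * B + Y * K) = B := by
    intro B K
    rw [Matrix.mul_add, ← Matrix.mul_assoc, ← Matrix.mul_assoc, hX, hXY]
    simp
  have e2 : (1 - X * Xᵀ) * (X * A' + Y * H') = Y * H' := by
    rw [Matrix.sub_mul, Matrix.mul_assoc, e]
    simp
  have hYX : Yᵀ * X = 0 := by
    have h := congrArg Matrix.transpose hXY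
    simpa using h
  have e3 : (X * A + Y * H)ᵀ * (Y * H') = Hᵀ * H' := by
    rw [Matrix.transpose_add, Matrix.transpose_mul, Matrix.transpose_mul, Matrix.add_mul,
      Matrix.mul_assoc, ← Matrix.mul_assoc Xᵀ, hXY, Matrix.mul_assoc, ← Matrix.mul_assoc Yᵀ, hY]
    simp
  rw [metric, e, e, Matrix.mul_assoc, e2, e3]

/-- Piecewise `C¹` curves `[0,1] → St(n,p)`: continuous curves for which there is a finite set of
breakpoints such that the curve is `C¹` on every closed subinterval of `[0,1]` without breakpoints
in its interior. -/
def IsPiecewiseC1Curve {n p : ℕ} (c : ℝ → Matrix (Fin n) (Fin p) ℝ) : Prop :=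
  ContinuousOn c (Set.Icc 0 1) ∧ (∀ t ∈ Set.Icc (0 : ℝ) 1, c t ∈ manifold n p) ∧
    ∃ S : Finset ℝ, ∀ a b : ℝ, 0 ≤ a → a < b → b ≤ 1 →
      (∀ s ∈ S, s ∉ Set.Ioo a b) → ContDiffOn ℝ 1 c (Set.Icc a b)

/-- The length of a piecewise `C¹` curve `[0,1] → St(n,p)`.  (The derivative exists outside a finite
set, which does not affect the integral.) -/
def curveLength {n p : ℕ} (β : ℝ) (c : ℝ → Matrix (Fin n) (Fin p) ℝ) : ℝ :=
  ∫ t in (0 : ℝ)..1, √(metric β (c t) (deriv c t) (deriv c t))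

/-- The Riemannian distance on `St(n,p)`: the infimum of the lengths of the piecewise `C¹` curves
from `X` to `Y` (and `∞` if there is none). -/
def riemannianDist {n p : ℕ} (β : ℝ) (X Y : Matrix (Fin n) (Fin p) ℝ) : ℝ≥0∞ :=
  ⨅ (c : ℝ → Matrix (Fin n) (Fin p) ℝ) (_ : IsPiecewiseC1Curve c ∧ c 0 = X ∧ c 1 = Y),
    ENNReal.ofReal (curveLength β c)

/-- The derivative, at the base point `X` in the direction `ζ`, of the metric coefficient
`X ↦ g_X(ξ, η)`, for constant `ξ` and `η`. -/
def metricDeriv {n p : ℕ} (β : ℝ) (X ζ ξ η : Matrix (Fin n) (Fin p) ℝ) : ℝ :=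
  fderiv ℝ (fun Z => metric β Z ξ η) X ζ

/-- `g(∇_{γ'} γ', η)` at time `t`, where `∇` is the Levi-Civita connection of the metric on the
ambient space, written out in the linear coordinates of that space (Christoffel symbols of the
first kind): `g(γ'', η) + (D_{γ'} g)(γ', η) - (D_η g)(γ', γ') / 2`.
Since the Levi-Civita connection of a submanifold with the induced metric is the tangential part of
the ambient one, for `η` tangent to `St(n,p)` at `γ t` this is also
`g(∇_{γ'} γ', η)` for the Levi-Civita connection of `St(n,p)`. -/
def covariantAcceleration {n p : ℕ} (β : ℝ) (γ : ℝ → Matrix (Fin n) (Fin p) ℝ) (t : ℝ)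
    (η : Matrix (Fin n) (Fin p) ℝ) : ℝ :=
  metric β (γ t) (deriv (deriv γ) t) η
    + metricDeriv β (γ t) (deriv γ t) (deriv γ t) η
    - metricDeriv β (γ t) η (deriv γ t) (deriv γ t) / 2

/-- Geodesics `ℝ → St(n,p)`: smooth curves in `St(n,p)` with `∇_{γ'} γ' = 0`. -/
def IsGeodesic {n p : ℕ} (β : ℝ) (γ : ℝ → Matrix (Fin n) (Fin p) ℝ) : Prop :=
  ContDiff ℝ ∞ γ ∧ (∀ t, γ t ∈ manifold n p) ∧
    ∀ t, ∀ η ∈ tangentSpace (γ t), covariantAcceleration β γ t η = 0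

/-- The cut time `sup {t > 0 | d(γ 0, γ t) = t}` of a unit-speed geodesic. -/
def cutTime {n p : ℕ} (β : ℝ) (γ : ℝ → Matrix (Fin n) (Fin p) ℝ) : ℝ≥0∞ :=
  ⨆ (t : ℝ) (_ : 0 < t ∧ riemannianDist β (γ 0) (γ t) = ENNReal.ofReal t), ENNReal.ofReal t

/-- The injectivity radius at `X`: the infimum of the cut times of the geodesics that start at `X`
with a unit tangent vector as initial velocity.  (As `St(n,p)` is complete, there is exactly one
geodesic `γ : ℝ → St(n,p)` for each such `ξ`.) -/
def injRadiusAt {n p : ℕ} (β : ℝ) (X : Matrix (Fin n) (Fin p) ℝ) : ℝ≥0∞ :=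
  ⨅ (ξ : Matrix (Fin n) (Fin p) ℝ) (_ : ξ ∈ tangentSpace X ∧ metric β X ξ ξ = 1)
    (γ : ℝ → Matrix (Fin n) (Fin p) ℝ) (_ : IsGeodesic β γ ∧ γ 0 = X ∧ deriv γ 0 = ξ),
    cutTime β γ

/-- The injectivity radius of `St(n,p)` with the metric of parameter `β`. -/
def injRadius (β : ℝ) (n p : ℕ) : ℝ≥0∞ :=
  ⨅ X ∈ manifold n p, injRadiusAt β X

end Stiefel

end

/-!
Upper bounds. For `q ≤ p` and `m - q ≤ n - p` the maps `Z ↦ Y Z Qᵀ + R` embed `St(m,q)` in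
`St(n,p)` isometrically and totally geodesically, and the image of a geodesic is cut no later in the
larger manifold. The circle `St(2,1)` therefore gives the bound `π`. For the canonical metric, the
frames `(x, Jx)` with `x` in the unit sphere of `ℝ⁴ = ℂ²` form a Berger sphere in `St(4,2)`. The
arc `(cos s, sin s)`, `0 ≤ s ≤ θ`, is a geodesic of length `√2 θ`, and nearby orbits of
one-parameter groups of isometries, with a small parameter `κ`, join the same two points. The square
of their length is `2 θ² + κ² (1 - (θ cot θ)²)` up to terms of higher order in `κ`, so they are
shorter than the arc as soon as `sin θ + θ cos θ < 0`.

Lower bounds. The spherical distance `arccos ⟨u, x⟩` to a fixed unit vector `u` grows at most as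
fast as arc length, so it calibrates the great circles when `p = 1`. For `p = n - 1` a frame is
completed to a rotation, and by Noether's theorem a canonical geodesic is the orbit of a fixed
skew-symmetric matrix. The spherical distances travelled by the singular vectors of this matrix,
weighted by half the singular values, add up to a calibration of the geodesic up to time `π`.
-/

noncomputable section

namespace Stiefel

attribute [local instance] Matrix.frobeniusNormedAddCommGroup Matrix.frobeniusNormedSpace

section SmallestRoot

open Finset Real

theorem sum_range_mul_I_pow_div_factorial (x : ℝ) (m : ℕ) :
    ∑ j ∈ range (2 * m), ((x : ℂ) * Complex.I) ^ j / (j.factorial : ℂ) =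
      ((∑ k ∈ range m, (-1) ^ k * x ^ (2 * k) / ((2 * k).factorial : ℝ) : ℝ) : ℂ) +
      ((∑ k ∈ range m, (-1) ^ k * x ^ (2 * k + 1) / ((2 * k + 1).factorial : ℝ) : ℝ) : ℂ) *
        Complex.I := by
  induction m with
  | zero => simp
  | succ m ih =>
    have even_pow : ((x : ℂ) * Complex.I) ^ (2 * m) = (-1) ^ m * (x : ℂ) ^ (2 * m) := by
      rw [mul_pow, pow_mul Complex.I, Complex.I_sq, mul_comm]
    rw [show 2 * (m + 1) = 2 * m + 1 + 1 by ring, sum_range_succ, sum_range_succ, ih,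
      sum_range_succ _ m, sum_range_succ _ m, pow_succ ((x : ℂ) * Complex.I), even_pow]
    push_cast
    ring

theorem norm_cos_add_sin_mul_I_sub_taylor_le {x : ℝ} {m : ℕ}
    (hx : |x| / ((2 * m).succ : ℝ) ≤ 1 / 2) :
    ‖((cos x - ∑ k ∈ range m, (-1) ^ k * x ^ (2 * k) / ((2 * k).factorial : ℝ) : ℝ) : ℂ) +
      ((sin x - ∑ k ∈ range m, (-1) ^ k * x ^ (2 * k + 1) / ((2 * k + 1).factorial : ℝ) : ℝ) : ℂ) *
        Complex.I‖ ≤ |x| ^ (2 * m) / ((2 * m).factorial : ℝ) * 2 := by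
  have norm_mul_I : ‖(x : ℂ) * Complex.I‖ = |x| := by simp
  have h := Complex.exp_bound' (x := (x : ℂ) * Complex.I) (n := 2 * m) (by rwa [norm_mul_I])
  rw [norm_mul_I, sum_range_mul_I_pow_div_factorial, Complex.exp_mul_I, ← Complex.ofReal_cos,
    ← Complex.ofReal_sin] at h
  refine (congrArg norm ?_).trans_le h
  rw [Complex.ofReal_sub, Complex.ofReal_sub]
  ring

theorem abs_cos_sub_taylor_le {x : ℝ} {m : ℕ} (hx : |x| / ((2 * m).succ : ℝ) ≤ 1 / 2) :
    |cos x - ∑ k ∈ range m, (-1) ^ k * x ^ (2 * k) / ((2 * k).factorial : ℝ)| ≤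
      |x| ^ (2 * m) / ((2 * m).factorial : ℝ) * 2 := by
  refine le_trans ?_ (norm_cos_add_sin_mul_I_sub_taylor_le hx)
  refine le_of_eq_of_le (congrArg abs ?_) (Complex.abs_re_le_norm _)
  rw [Complex.add_re, Complex.ofReal_re, Complex.re_ofReal_mul, Complex.I_re, mul_zero, add_zero]

theorem abs_sin_sub_taylor_le {x : ℝ} {m : ℕ} (hx : |x| / ((2 * m).succ : ℝ) ≤ 1 / 2) :
    |sin x - ∑ k ∈ range m, (-1) ^ k * x ^ (2 * k + 1) / ((2 * k + 1).factorial : ℝ)| ≤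
      |x| ^ (2 * m) / ((2 * m).factorial : ℝ) * 2 := by
  refine le_trans ?_ (norm_cos_add_sin_mul_I_sub_taylor_le hx)
  refine le_of_eq_of_le (congrArg abs ?_) (Complex.abs_im_le_norm _)
  rw [Complex.add_im, Complex.ofReal_im, Complex.im_ofReal_mul, Complex.I_im, mul_one, zero_add]

/-- The derivative `sin t + t cos t` of `t ↦ t sin t`; for `t > 0` it vanishes exactly when
`sin t / t + cos t` does. -/
def sinAddMulCos (t : ℝ) : ℝ := sin t + t * cos t

theorem hasDerivAt_sinAddMulCos (t : ℝ) :
    HasDerivAt sinAddMulCos (2 * cos t - t * sin t) t := by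
  have h := (hasDerivAt_sin t).add ((hasDerivAt_id' t).mul (hasDerivAt_cos t))
  exact h.congr_deriv (by ring)

theorem continuous_sinAddMulCos : Continuous sinAddMulCos :=
  continuous_iff_continuousAt.2 fun t => (hasDerivAt_sinAddMulCos t).continuousAt

theorem sin_div_add_cos_eq {t : ℝ} (ht : t ≠ 0) : sin t / t + cos t = sinAddMulCos t / t := by
  rw [sinAddMulCos, add_div, mul_div_cancel_left₀ _ ht]

theorem sinAddMulCos_pos_of_le_pi_div_two {t : ℝ} (h0 : 0 < t) (h1 : t ≤ π / 2) :
    0 < sinAddMulCos t := by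
  have hs : 0 < sin t := sin_pos_of_pos_of_lt_pi h0 (by linarith [pi_pos])
  have hc : 0 ≤ cos t := cos_nonneg_of_mem_Icc ⟨by linarith, h1⟩
  unfold sinAddMulCos
  positivity

theorem strictAntiOn_sinAddMulCos : StrictAntiOn sinAddMulCos (Set.Icc (π / 2) π) := by
  refine strictAntiOn_of_deriv_neg (convex_Icc _ _) continuous_sinAddMulCos.continuousOn ?_
  rw [interior_Icc]
  rintro t ⟨ht1, ht2⟩
  have hc : cos t < 0 := cos_neg_of_pi_div_two_lt_of_lt ht1 (by linarith)
  have hs : 0 < sin t := sin_pos_of_pos_of_lt_pi (by linarith [pi_pos]) ht2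
  have ht0 : 0 < t := by linarith [pi_pos]
  rw [(hasDerivAt_sinAddMulCos t).deriv]
  linarith [mul_pos ht0 hs]

theorem sinAddMulCos_pos_of_lt {τ t : ℝ} (hτ : τ ∈ Set.Icc (π / 2) π) (h : sinAddMulCos τ = 0)
    (ht : 0 < t) (htτ : t < τ) : 0 < sinAddMulCos t := by
  rcases le_total t (π / 2) with ht' | ht'
  · exact sinAddMulCos_pos_of_le_pi_div_two ht ht'
  · exact h ▸ strictAntiOn_sinAddMulCos ⟨ht', htτ.le.trans hτ.2⟩ hτ htτ

theorem sinAddMulCos_neg_of_gt {τ t : ℝ} (hτ : τ ∈ Set.Icc (π / 2) π) (h : sinAddMulCos τ = 0)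
    (htτ : τ < t) (ht : t ≤ π) : sinAddMulCos t < 0 :=
  h ▸ strictAntiOn_sinAddMulCos hτ ⟨hτ.1.trans htτ.le, ht⟩ htτ

theorem isLeast_of_sinAddMulCos_eq_zero {τ : ℝ} (hτ : τ ∈ Set.Icc (π / 2) π)
    (h : sinAddMulCos τ = 0) : IsLeast {t : ℝ | 0 < t ∧ sin t / t + cos t = 0} τ := by
  have hτ0 : 0 < τ := pi_div_two_pos.trans_le hτ.1
  refine ⟨⟨hτ0, by rw [sin_div_add_cos_eq hτ0.ne', h, zero_div]⟩, fun t ⟨ht0, ht⟩ => ?_⟩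
  rw [sin_div_add_cos_eq ht0.ne'] at ht
  by_contra! htτ
  exact (div_pos (sinAddMulCos_pos_of_lt hτ h ht0 htτ) ht0).ne' ht

theorem sinAddMulCos_lower_pos : 0 < sinAddMulCos 2.02875783811043 := by
  have hx : |(2.02875783811043 : ℝ)| / ((2 * 15 : ℕ).succ : ℝ) ≤ 1 / 2 := by
    norm_num [abs_of_pos]
  have hc := (abs_le.1 (abs_cos_sub_taylor_le hx)).1
  have hs := (abs_le.1 (abs_sin_sub_taylor_le hx)).1
  rw [abs_of_pos (by norm_num)] at hc hs
  norm_num [sum_range_succ, Nat.factorial] at hc hs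
  norm_num [sinAddMulCos]
  linarith

theorem sinAddMulCos_upper_neg : sinAddMulCos 2.02875783811044 < 0 := by
  have hx : |(2.02875783811044 : ℝ)| / ((2 * 15 : ℕ).succ : ℝ) ≤ 1 / 2 := by
    norm_num [abs_of_pos]
  have hc := (abs_le.1 (abs_cos_sub_taylor_le hx)).2
  have hs := (abs_le.1 (abs_sin_sub_taylor_le hx)).2
  rw [abs_of_pos (by norm_num)] at hc hs
  norm_num [sum_range_succ, Nat.factorial] at hc hs
  norm_num [sinAddMulCos]
  linarith

theorem exists_sinAddMulCos_eq_zero :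
    ∃ τ ∈ Set.Ioo (2.02875783811043 : ℝ) 2.02875783811044, sinAddMulCos τ = 0 :=
  intermediate_value_Ioo' (by norm_num) continuous_sinAddMulCos.continuousOn
    ⟨sinAddMulCos_upper_neg, sinAddMulCos_lower_pos⟩

theorem abs_mul_sqrt_two_div_pi_sub_le {τ : ℝ}
    (hτ : τ ∈ Set.Ioo (2.02875783811043 : ℝ) 2.02875783811044) :
    |τ * √2 / π - 0.91326189159122| ≤ 5 / 10 ^ 15 := by
  obtain ⟨hτ1, hτ2⟩ := hτ
  have hs1 : (1.41421356237309504880 : ℝ) < √2 := lt_sqrt_of_sq_lt (by norm_num)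
  have hs2 : √2 < (1.41421356237309504881 : ℝ) := (sqrt_lt' (by norm_num)).2 (by norm_num)
  have lower : (2.02875783811043 : ℝ) * 1.41421356237309504880 ≤ τ * √2 := by gcongr
  have upper : τ * √2 ≤ (2.02875783811044 : ℝ) * 1.41421356237309504881 := by gcongr
  rw [abs_le, neg_le_sub_iff_le_add, ← sub_le_iff_le_add, le_div_iff₀ pi_pos, sub_le_iff_le_add,
    div_le_iff₀ pi_pos]
  constructor <;> linarith [pi_gt_d20, pi_lt_d20]

end SmallestRoot

section Curves

open Set MeasureTheory Topology

theorem relation_of_forall_notMem_Ioo {α : Type*} [LinearOrder α] {P : α → α → Prop} (S : Finset α)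
    (trans : ∀ a s b, a < s → s < b → P a s → P s b → P a b)
    (base : ∀ a b, a < b → (∀ s ∈ S, s ∉ Ioo a b) → P a b) : ∀ a b, a < b → P a b := by
  induction S using Finset.induction_on with
  | empty => exact fun a b hab => base a b hab fun s hs => absurd hs (Finset.notMem_empty s)
  | insert s S _ ih =>
    refine ih fun a b hab hS => ?_
    by_cases hs : s ∈ Ioo a b
    · refine trans a s b hs.1 hs.2 (base a s hs.1 ?_) (base s b hs.2 ?_)
      · rw [Finset.forall_mem_insert]
        exact ⟨fun h => h.2.false, fun r hr h => hS r hr ⟨h.1, h.2.trans hs.2⟩⟩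
      · rw [Finset.forall_mem_insert]
        exact ⟨fun h => h.1.false, fun r hr h => hS r hr ⟨hs.1.trans h.1, h.2⟩⟩
    · exact base a b hab (Finset.forall_mem_insert .. |>.2 ⟨hs, hS⟩)

section C1Curve

variable {E : Type*}

/-- The concatenation of two curves parametrized by `[0,1]`, each run through at double speed. -/
def concat (c₁ c₂ : ℝ → E) (t : ℝ) : E :=
  if t ≤ 1 / 2 then c₁ (2 * t) else c₂ (2 * t - 1)

variable {c₁ c₂ : ℝ → E}

theorem concat_of_le {t : ℝ} (ht : t ≤ 1 / 2) : concat c₁ c₂ t = c₁ (2 * t) := if_pos ht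

theorem concat_of_ge (h : c₁ 1 = c₂ 0) {t : ℝ} (ht : 1 / 2 ≤ t) :
    concat c₁ c₂ t = c₂ (2 * t - 1) := by
  rcases ht.eq_or_lt with rfl | ht
  · rw [concat_of_le le_rfl]; norm_num [h]
  · exact if_neg ht.not_ge

theorem continuousOn_concat [TopologicalSpace E] (h₁ : ContinuousOn c₁ (Icc 0 1))
    (h₂ : ContinuousOn c₂ (Icc 0 1)) (h : c₁ 1 = c₂ 0) : ContinuousOn (concat c₁ c₂) (Icc 0 1) := by
  rw [← Icc_union_Icc_eq_Icc (b := (1 / 2 : ℝ)) (by norm_num) (by norm_num)]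
  refine ContinuousOn.union_of_isClosed ?_ ?_ isClosed_Icc isClosed_Icc
  · refine ContinuousOn.congr (h₁.comp (f := fun t => 2 * t) (by fun_prop) fun t ht => ?_)
      fun t ht => concat_of_le ht.2
    constructor <;> linarith [ht.1, ht.2]
  · refine ContinuousOn.congr (h₂.comp (f := fun t => 2 * t - 1) (by fun_prop) fun t ht => ?_)
      fun t ht => concat_of_ge h ht.1
    constructor <;> linarith [ht.1, ht.2]

variable [NormedAddCommGroup E] [NormedSpace ℝ E]

theorem intervalIntegrable_of_contDiffOn {σ : E → E → ℝ}
    (hσ : Continuous fun q : E × E => σ q.1 q.2) {c : ℝ → E} {a b : ℝ} (hab : a < b)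
    (hc : ContDiffOn ℝ 1 c (Icc a b)) :
    IntervalIntegrable (fun t => σ (c t) (deriv c t)) volume a b := by
  have hcont : ContinuousOn (fun t => σ (c t) (derivWithin c (Icc a b) t)) (Icc a b) :=
    hσ.comp_continuousOn
      (hc.continuousOn.prodMk (hc.continuousOn_derivWithin (uniqueDiffOn_Icc hab) le_rfl))
  refine (hcont.intervalIntegrable_of_Icc hab.le).congr_uIoo fun t ht => ?_
  rw [uIoo_of_le hab.le] at ht
  simp only [derivWithin_of_mem_nhds (Icc_mem_nhds ht.1 ht.2)]

theorem sub_le_integral_of_contDiffOn {σ : E → E → ℝ}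
    (hσ : Continuous fun q : E × E => σ q.1 q.2) {c : ℝ → E} {a b : ℝ} (hab : a < b)
    (hc : ContDiffOn ℝ 1 c (Icc a b)) {g : ℝ → ℝ} (hg : ContinuousOn g (Icc a b))
    (hderiv : ∀ t ∈ Ioo a b, ∀ ξ, HasDerivAt c ξ t → ∃ k, HasDerivAt g k t ∧ k ≤ σ (c t) ξ) :
    g b - g a ≤ ∫ t in a..b, σ (c t) (deriv c t) := by
  have hcd : ∀ t ∈ Ioo a b, HasDerivAt c (deriv c t) t := fun t ht =>
    ((hc.differentiableOn one_ne_zero t (Ioo_subset_Icc_self ht)).differentiableAt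
      (Icc_mem_nhds ht.1 ht.2)).hasDerivAt
  choose! g' hg' hle using fun t ht => hderiv t ht _ (hcd t ht)
  exact intervalIntegral.sub_le_integral_of_hasDeriv_right_of_le hab.le hg
    (fun t ht => (hg' t ht).hasDerivWithinAt)
    ((intervalIntegrable_iff_integrableOn_Icc_of_le hab.le).1
      (intervalIntegrable_of_contDiffOn hσ hab hc)) hle

theorem contDiffOn_concat_left {a b : ℝ} (hb : b ≤ 1 / 2)
    (h₁ : ContDiffOn ℝ 1 c₁ (Icc (2 * a) (2 * b))) : ContDiffOn ℝ 1 (concat c₁ c₂) (Icc a b) := by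
  refine ContDiffOn.congr (h₁.comp (f := fun t => 2 * t) (by fun_prop) fun t ht => ?_)
    fun t ht => concat_of_le (ht.2.trans hb)
  constructor <;> linarith [ht.1, ht.2]

theorem contDiffOn_concat_right (h : c₁ 1 = c₂ 0) {a b : ℝ} (ha : 1 / 2 ≤ a)
    (h₂ : ContDiffOn ℝ 1 c₂ (Icc (2 * a - 1) (2 * b - 1))) :
    ContDiffOn ℝ 1 (concat c₁ c₂) (Icc a b) := by
  refine ContDiffOn.congr (h₂.comp (f := fun t => 2 * t - 1) (by fun_prop) fun t ht => ?_)
    fun t ht => concat_of_ge h (ha.trans ht.1)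
  constructor <;> linarith [ht.1, ht.2]

end C1Curve

variable {n p : ℕ} {β : ℝ}

section Speed

theorem metric_smul_smul (β k : ℝ) (X ξ : Matrix (Fin n) (Fin p) ℝ) :
    metric β X (k • ξ) (k • ξ) = k ^ 2 * metric β X ξ ξ := by
  simp only [metric, Matrix.transpose_smul, Matrix.mul_smul, Matrix.smul_mul, Matrix.trace_smul,
    smul_eq_mul]
  ring

theorem continuous_sqrt_metric (β : ℝ) :
    Continuous fun q : Matrix (Fin n) (Fin p) ℝ × Matrix (Fin n) (Fin p) ℝ =>
      √(metric β q.1 q.2 q.2) := by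
  unfold metric
  fun_prop

/-- The speed of a curve at time `t`, the integrand of `curveLength`. -/
def speed (β : ℝ) (c : ℝ → Matrix (Fin n) (Fin p) ℝ) (t : ℝ) : ℝ :=
  √(metric β (c t) (deriv c t) (deriv c t))

theorem speed_congr {c c' : ℝ → Matrix (Fin n) (Fin p) ℝ} {t : ℝ} (h : c =ᶠ[𝓝 t] c') :
    speed β c t = speed β c' t := by
  have hderiv : deriv c t = deriv c' t := h.deriv_eq
  rw [speed, speed, h.eq_of_nhds, hderiv]

theorem speed_comp_affine (c : ℝ → Matrix (Fin n) (Fin p) ℝ) (k a t : ℝ) :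
    speed β (fun s => c (k * s + a)) t = |k| * speed β c (k * t + a) := by
  have h : deriv (fun s => c (k * s + a)) t = k • deriv c (k * t + a) :=
    (deriv_comp_mul_left k (fun s => c (s + a)) t).trans (congrArg _ (deriv_comp_add_const ..))
  rw [speed, h, metric_smul_smul, Real.sqrt_mul (sq_nonneg k), Real.sqrt_sq_eq_abs, speed]

theorem speed_concat_of_lt {c₁ c₂ : ℝ → Matrix (Fin n) (Fin p) ℝ} {t : ℝ} (ht : t < 1 / 2) :
    speed β (concat c₁ c₂) t = 2 * speed β c₁ (2 * t) := by
  have h : concat c₁ c₂ =ᶠ[𝓝 t] fun s => c₁ (2 * s + 0) := by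
    filter_upwards [Iio_mem_nhds ht] with s hs
    rw [add_zero, concat_of_le (mem_Iio.1 hs).le]
  rw [speed_congr h, speed_comp_affine, abs_two, add_zero]

theorem speed_concat_of_gt {c₁ c₂ : ℝ → Matrix (Fin n) (Fin p) ℝ} (h : c₁ 1 = c₂ 0) {t : ℝ}
    (ht : 1 / 2 < t) : speed β (concat c₁ c₂) t = 2 * speed β c₂ (2 * t - 1) := by
  have h : concat c₁ c₂ =ᶠ[𝓝 t] fun s => c₂ (2 * s + -1) := by
    filter_upwards [Ioi_mem_nhds ht] with s hs
    rw [← sub_eq_add_neg, concat_of_ge h (mem_Ioi.1 hs).le]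
  rw [speed_congr h, speed_comp_affine, abs_two, sub_eq_add_neg]

end Speed

section Length

variable {c c₁ c₂ : ℝ → Matrix (Fin n) (Fin p) ℝ}

theorem IsPiecewiseC1Curve.of_contDiff (hc : ContDiff ℝ 1 c) (hmem : ∀ t, c t ∈ manifold n p) :
    IsPiecewiseC1Curve c :=
  ⟨hc.continuous.continuousOn, fun t _ => hmem t, ∅, fun _ _ _ _ _ _ => hc.contDiffOn⟩

theorem IsPiecewiseC1Curve.intervalIntegrable_speed (hc : IsPiecewiseC1Curve c) :
    IntervalIntegrable (speed β c) volume 0 1 := by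
  obtain ⟨-, -, S, hS⟩ := hc
  refine relation_of_forall_notMem_Ioo
    (P := fun a b => 0 ≤ a → b ≤ 1 → IntervalIntegrable (speed β c) volume a b) S ?_ ?_
    0 1 one_pos le_rfl le_rfl
  · exact fun a s b has hsb h₁ h₂ ha hb =>
      (h₁ ha (hsb.le.trans hb)).trans (h₂ (ha.trans has.le) hb)
  · exact fun a b hab hno ha hb =>
      intervalIntegrable_of_contDiffOn (σ := fun X ξ => √(metric β X ξ ξ))
        (continuous_sqrt_metric β) hab (hS a b ha hab hb hno)

/-- The calibration principle: a function that grows along `c` at most as fast as arc length bounds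
the length of `c` from below. -/
theorem IsPiecewiseC1Curve.sub_le_curveLength (hc : IsPiecewiseC1Curve c) {g : ℝ → ℝ}
    (hg : ContinuousOn g (Icc 0 1))
    (hderiv : ∀ t ∈ Ioo (0 : ℝ) 1, ∀ ξ, HasDerivAt c ξ t →
      ∃ k, HasDerivAt g k t ∧ k ≤ √(metric β (c t) ξ ξ)) :
    g 1 - g 0 ≤ curveLength β c := by
  have hint : IntervalIntegrable (speed β c) volume 0 1 := hc.intervalIntegrable_speed
  obtain ⟨-, -, S, hS⟩ := hc
  refine relation_of_forall_notMem_Ioo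
    (P := fun a b => 0 ≤ a → b ≤ 1 → g b - g a ≤ ∫ t in a..b, speed β c t) S ?_ ?_
    0 1 one_pos le_rfl le_rfl
  · intro a s b has hsb h₁ h₂ ha hb
    have hsub : ∀ x y, 0 ≤ x → x ≤ y → y ≤ 1 → IntervalIntegrable (speed β c) volume x y := by
      intro x y hx hxy hy
      refine hint.mono_set ?_
      rw [uIcc_of_le hxy, uIcc_of_le zero_le_one]
      exact Icc_subset_Icc hx hy
    rw [← intervalIntegral.integral_add_adjacent_intervals
      (hsub a s ha has.le (hsb.le.trans hb)) (hsub s b (ha.trans has.le) hsb.le hb)]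
    linarith [h₁ ha (hsb.le.trans hb), h₂ (ha.trans has.le) hb]
  · intro a b hab hno ha hb
    exact sub_le_integral_of_contDiffOn (σ := fun X ξ => √(metric β X ξ ξ))
      (continuous_sqrt_metric β) hab (hS a b ha hab hb hno)
      (hg.mono (Icc_subset_Icc ha hb)) fun t ht => hderiv t (Ioo_subset_Ioo ha hb ht)

theorem IsPiecewiseC1Curve.concat (hc₁ : IsPiecewiseC1Curve c₁) (hc₂ : IsPiecewiseC1Curve c₂)
    (h : c₁ 1 = c₂ 0) : IsPiecewiseC1Curve (concat c₁ c₂) := by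
  obtain ⟨hcont₁, hmem₁, S₁, hS₁⟩ := hc₁
  obtain ⟨hcont₂, hmem₂, S₂, hS₂⟩ := hc₂
  refine ⟨continuousOn_concat hcont₁ hcont₂ h, fun t ht => ?_,
    insert (1 / 2) (S₁.image (fun s => s / 2) ∪ S₂.image fun s => (s + 1) / 2),
    fun a b ha hab hb hno => ?_⟩
  · rcases le_total t (1 / 2) with ht' | ht'
    · rw [concat_of_le ht']
      exact hmem₁ _ ⟨by linarith [ht.1], by linarith⟩
    · rw [concat_of_ge h ht']
      exact hmem₂ _ ⟨by linarith, by linarith [ht.2]⟩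
  · simp only [Finset.forall_mem_insert, Finset.forall_mem_union, Finset.forall_mem_image] at hno
    obtain ⟨hmid, hno₁, hno₂⟩ := hno
    rcases le_or_gt b (1 / 2) with hb' | hb'
    · refine contDiffOn_concat_left hb'
        (hS₁ _ _ (by linarith) (by linarith) (by linarith) fun s hs hsI => hno₁ hs ?_)
      constructor <;> linarith [hsI.1, hsI.2]
    · have ha' : 1 / 2 ≤ a := not_lt.1 fun ha' => hmid ⟨ha', hb'⟩
      refine contDiffOn_concat_right h ha'
        (hS₂ _ _ (by linarith) (by linarith) (by linarith) fun s hs hsI => hno₂ hs ?_)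
      constructor <;> linarith [hsI.1, hsI.2]

theorem curveLength_concat (hc₁ : IsPiecewiseC1Curve c₁) (hc₂ : IsPiecewiseC1Curve c₂)
    (h : c₁ 1 = c₂ 0) :
    curveLength β (concat c₁ c₂) = curveLength β c₁ + curveLength β c₂ := by
  have hint : IntervalIntegrable (speed β (concat c₁ c₂)) volume 0 1 :=
    (hc₁.concat hc₂ h).intervalIntegrable_speed
  have hmid : (1 / 2 : ℝ) ∈ uIcc 0 1 := by
    rw [uIcc_of_le zero_le_one]; constructor <;> norm_num
  have left : ∫ t in (0 : ℝ)..1 / 2, speed β (concat c₁ c₂) t = curveLength β c₁ := by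
    rw [intervalIntegral.integral_congr_Ioo_of_le (g := fun t => 2 * speed β c₁ (2 * t))
      (by norm_num) fun t ht => speed_concat_of_lt ht.2, intervalIntegral.integral_const_mul,
      ← smul_eq_mul, intervalIntegral.smul_integral_comp_mul_left]
    norm_num [curveLength, speed]
  have right : ∫ t in (1 / 2 : ℝ)..1, speed β (concat c₁ c₂) t = curveLength β c₂ := by
    rw [intervalIntegral.integral_congr_Ioo_of_le (g := fun t => 2 * speed β c₂ (2 * t - 1))
      (by norm_num) fun t ht => speed_concat_of_gt h ht.1, intervalIntegral.integral_const_mul,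
      ← smul_eq_mul, intervalIntegral.smul_integral_comp_mul_sub (speed β c₂)]
    norm_num [curveLength, speed]
  calc curveLength β (concat c₁ c₂)
      = ∫ t in (0 : ℝ)..1, speed β (concat c₁ c₂) t := rfl
    _ = (∫ t in (0 : ℝ)..1 / 2, speed β (concat c₁ c₂) t) +
          ∫ t in (1 / 2 : ℝ)..1, speed β (concat c₁ c₂) t :=
        (intervalIntegral.integral_add_adjacent_intervals
          (hint.mono_set (uIcc_subset_uIcc_left hmid))
          (hint.mono_set (uIcc_subset_uIcc_right hmid))).symm
    _ = curveLength β c₁ + curveLength β c₂ := by rw [left, right]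

end Length

section Distance

theorem riemannianDist_triangle (β : ℝ) (X Y Z : Matrix (Fin n) (Fin p) ℝ) :
    riemannianDist β X Z ≤ riemannianDist β X Y + riemannianDist β Y Z := by
  have concat_le : ∀ c₁ : ℝ → Matrix (Fin n) (Fin p) ℝ,
      IsPiecewiseC1Curve c₁ ∧ c₁ 0 = X ∧ c₁ 1 = Y →
      ∀ c₂ : ℝ → Matrix (Fin n) (Fin p) ℝ, IsPiecewiseC1Curve c₂ ∧ c₂ 0 = Y ∧ c₂ 1 = Z →
      riemannianDist β X Z ≤
        ENNReal.ofReal (curveLength β c₁) + ENNReal.ofReal (curveLength β c₂) := by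
    rintro c₁ ⟨hc₁, hX, hY⟩ c₂ ⟨hc₂, hY', hZ⟩
    have h : c₁ 1 = c₂ 0 := hY.trans hY'.symm
    have nonneg : ∀ c : ℝ → Matrix (Fin n) (Fin p) ℝ, 0 ≤ curveLength β c := fun c =>
      intervalIntegral.integral_nonneg zero_le_one fun t _ => Real.sqrt_nonneg _
    rw [← ENNReal.ofReal_add (nonneg c₁) (nonneg c₂), ← curveLength_concat hc₁ hc₂ h]
    refine iInf₂_le (concat c₁ c₂) ⟨hc₁.concat hc₂ h, ?_, ?_⟩
    · rw [concat_of_le (by norm_num), mul_zero, hX]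
    · rw [concat_of_ge h (by norm_num)]; norm_num [hZ]
  conv_rhs => rw [riemannianDist, riemannianDist]
  simp only [ENNReal.iInf_add, ENNReal.add_iInf]
  exact le_iInf₂ fun c₂ hc₂ => le_iInf₂ fun c₁ hc₁ => by exact concat_le _ ‹_› _ ‹_›

variable {γ : ℝ → Matrix (Fin n) (Fin p) ℝ}

theorem riemannianDist_le_of_speed_eq (hγ : ContDiff ℝ 1 γ) (hmem : ∀ t, γ t ∈ manifold n p) {k : ℝ}
    (hs : ∀ t, speed β γ t = k) (a b : ℝ) :
    riemannianDist β (γ a) (γ b) ≤ ENNReal.ofReal (|b - a| * k) := by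
  have length_eq : curveLength β (fun s => γ ((b - a) * s + a)) = |b - a| * k := by
    calc curveLength β (fun s => γ ((b - a) * s + a))
        = ∫ s in (0 : ℝ)..1, speed β (fun s => γ ((b - a) * s + a)) s := rfl
      _ = |b - a| * k := by simp only [speed_comp_affine, hs]; simp
  rw [← length_eq]
  refine iInf₂_le _ ⟨.of_contDiff (hγ.comp (by fun_prop)) fun s => hmem _, ?_, ?_⟩ <;> simp

theorem cutTime_le_of_riemannianDist_lt (hγ : ContDiff ℝ 1 γ) (hmem : ∀ t, γ t ∈ manifold n p)
    (hs : ∀ t, speed β γ t = 1) {t : ℝ}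
    (ht : riemannianDist β (γ 0) (γ t) < ENNReal.ofReal t) : cutTime β γ ≤ ENNReal.ofReal t := by
  refine iSup₂_le fun s ⟨_, hds⟩ => ENNReal.ofReal_le_ofReal ?_
  have ht0 : 0 < t := ENNReal.ofReal_pos.1 (bot_le.trans_lt ht)
  by_contra! hts
  refine lt_irrefl (ENNReal.ofReal s) ?_
  calc ENNReal.ofReal s = riemannianDist β (γ 0) (γ s) := hds.symm
    _ ≤ riemannianDist β (γ 0) (γ t) + riemannianDist β (γ t) (γ s) := riemannianDist_triangle ..
    _ ≤ riemannianDist β (γ 0) (γ t) + ENNReal.ofReal (|s - t| * 1) :=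
        add_le_add_right (riemannianDist_le_of_speed_eq hγ hmem hs t s) _
    _ < ENNReal.ofReal t + ENNReal.ofReal (|s - t| * 1) :=
        ENNReal.add_lt_add_right ENNReal.ofReal_ne_top ht
    _ = ENNReal.ofReal s := by
        rw [← ENNReal.ofReal_add ht0.le (by positivity), abs_of_pos (sub_pos.2 hts), mul_one,
          add_sub_cancel]

theorem cutTime_le_of_forall_gt (hγ : ContDiff ℝ 1 γ) (hmem : ∀ t, γ t ∈ manifold n p)
    (hs : ∀ t, speed β γ t = 1) {b : ℝ}
    (h : ∀ b' > b, ∃ t < b', riemannianDist β (γ 0) (γ t) < ENNReal.ofReal t) :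
    cutTime β γ ≤ ENNReal.ofReal b := by
  have hlim : Filter.Tendsto ENNReal.ofReal (𝓝[>] b) (𝓝 (ENNReal.ofReal b)) :=
    (ENNReal.continuous_ofReal.tendsto b).mono_left nhdsWithin_le_nhds
  refine ge_of_tendsto hlim ?_
  filter_upwards [self_mem_nhdsWithin] with b' hb'
  obtain ⟨t, htb, ht⟩ := h b' hb'
  exact (cutTime_le_of_riemannianDist_lt hγ hmem hs ht).trans (ENNReal.ofReal_le_ofReal htb.le)

theorem le_cutTime (hγ : ContDiff ℝ 1 γ) (hmem : ∀ t, γ t ∈ manifold n p)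
    (hs : ∀ t, speed β γ t = 1) {b : ℝ} (hb : 0 < b)
    (h : ∀ c : ℝ → Matrix (Fin n) (Fin p) ℝ, IsPiecewiseC1Curve c → c 0 = γ 0 → c 1 = γ b →
      b ≤ curveLength β c) :
    ENNReal.ofReal b ≤ cutTime β γ := by
  refine le_iSup₂_of_le b ⟨hb, le_antisymm ?_ ?_⟩ le_rfl
  · simpa [abs_of_pos hb] using riemannianDist_le_of_speed_eq hγ hmem hs 0 b
  · exact le_iInf₂ fun c ⟨hc, h0, h1⟩ => ENNReal.ofReal_le_ofReal (h c hc h0 h1)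

end Distance

end Curves

section MatrixCalculus

variable {ι κ μ : Type*}

theorem hasDerivAt_matrix [Finite κ] {A : ℝ → Matrix ι κ ℝ} {A' : Matrix ι κ ℝ} {t : ℝ} :
    HasDerivAt A A' t ↔ ∀ i j, HasDerivAt (fun s => A s i j) (A' i j) t := by
  have := Fintype.ofFinite κ
  have rows : HasDerivAt A A' t ↔ ∀ i, HasDerivAt (fun s => A s i) (A' i) t :=
    hasDerivAt_pi (φ := fun s => (A s : ι → κ → ℝ)) (φ' := A')
  rw [rows]
  exact forall_congr' fun i => hasDerivAt_pi

theorem contDiff_matrix [Fintype ι] [Fintype κ] {k : WithTop ℕ∞} {E : Type*}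
    [NormedAddCommGroup E] [NormedSpace ℝ E] {A : E → Matrix ι κ ℝ} :
    ContDiff ℝ k A ↔ ∀ i j, ContDiff ℝ k fun s => A s i j := by
  let e : Matrix ι κ ℝ ≃L[ℝ] (ι → κ → ℝ) :=
    LinearEquiv.toContinuousLinearEquiv (LinearEquiv.refl ℝ (ι → κ → ℝ) : Matrix ι κ ℝ ≃ₗ[ℝ] _)
  have entrywise : ContDiff ℝ k A ↔ ContDiff ℝ k fun s => e (A s) :=
    (e.comp_contDiff_iff (f := A)).symm
  rw [entrywise, contDiff_pi]
  exact forall_congr' fun i => contDiff_pi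

theorem contDiff_matrix_mul [Fintype ι] [Fintype κ] [Fintype μ] {k : WithTop ℕ∞} {E : Type*}
    [NormedAddCommGroup E] [NormedSpace ℝ E] {A : E → Matrix ι κ ℝ} {B : E → Matrix κ μ ℝ}
    (hA : ContDiff ℝ k A) (hB : ContDiff ℝ k B) : ContDiff ℝ k fun s => A s * B s := by
  rw [contDiff_matrix] at hA hB ⊢
  exact fun i j => ContDiff.sum fun l _ => (hA i l).mul (hB l j)

theorem hasDerivAt_matrix_mul [Fintype κ] [Finite μ] {A : ℝ → Matrix ι κ ℝ} {B : ℝ → Matrix κ μ ℝ}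
    {A' : Matrix ι κ ℝ} {B' : Matrix κ μ ℝ} {t : ℝ} (hA : HasDerivAt A A' t)
    (hB : HasDerivAt B B' t) : HasDerivAt (fun s => A s * B s) (A' * B t + A t * B') t := by
  rw [hasDerivAt_matrix] at hA hB ⊢
  intro i j
  simp only [Matrix.mul_apply, Matrix.add_apply, ← Finset.sum_add_distrib]
  exact HasDerivAt.fun_sum fun k _ => (hA i k).mul (hB k j)

theorem hasDerivAt_matrix_transpose [Finite ι] [Finite κ] {A : ℝ → Matrix ι κ ℝ}
    {A' : Matrix ι κ ℝ} {t : ℝ} (hA : HasDerivAt A A' t) : HasDerivAt (fun s => (A s)ᵀ) A'ᵀ t := by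
  rw [hasDerivAt_matrix] at hA ⊢
  exact fun i j => hA j i

theorem hasDerivAt_matrix_trace [Fintype κ] {A : ℝ → Matrix κ κ ℝ} {A' : Matrix κ κ ℝ} {t : ℝ}
    (hA : HasDerivAt A A' t) : HasDerivAt (fun s => (A s).trace) A'.trace t := by
  rw [hasDerivAt_matrix] at hA
  exact HasDerivAt.fun_sum fun i _ => hA i i

end MatrixCalculus

section MetricFormulas

variable {n p : ℕ} (β : ℝ)

theorem metric_eq (X ξ η : Matrix (Fin n) (Fin p) ℝ) :
    metric β X ξ η = (ξᵀ * η).trace - (1 - β) * ((Xᵀ * ξ)ᵀ * (Xᵀ * η)).trace := by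
  simp only [metric, Matrix.transpose_mul, Matrix.transpose_transpose, Matrix.mul_sub,
    Matrix.sub_mul, Matrix.trace_sub, Matrix.mul_one, Matrix.mul_assoc]
  ring

theorem metric_comm (X ξ η : Matrix (Fin n) (Fin p) ℝ) : metric β X ξ η = metric β X η ξ := by
  have trace_comm {m : ℕ} (A B : Matrix (Fin m) (Fin p) ℝ) :
      (Aᵀ * B).trace = (Bᵀ * A).trace := by
    rw [← Matrix.trace_transpose, Matrix.transpose_mul, Matrix.transpose_transpose]
  rw [metric_eq, metric_eq, trace_comm ξ, trace_comm (Xᵀ * ξ)]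

theorem hasDerivAt_metric {X ξ η : ℝ → Matrix (Fin n) (Fin p) ℝ}
    {X' ξ' η' : Matrix (Fin n) (Fin p) ℝ} {t : ℝ} (hX : HasDerivAt X X' t)
    (hξ : HasDerivAt ξ ξ' t) (hη : HasDerivAt η η' t) :
    HasDerivAt (fun s => metric β (X s) (ξ s) (η s))
      (metric β (X t) ξ' (η t) + metric β (X t) (ξ t) η' - (1 - β) *
        ((X'ᵀ * ξ t)ᵀ * ((X t)ᵀ * η t) + ((X t)ᵀ * ξ t)ᵀ * (X'ᵀ * η t)).trace) t := by
  have hT {A B : ℝ → Matrix (Fin n) (Fin p) ℝ} {A' B' : Matrix (Fin n) (Fin p) ℝ}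
      (hA : HasDerivAt A A' t) (hB : HasDerivAt B B' t) :=
    hasDerivAt_matrix_mul (hasDerivAt_matrix_transpose hA) hB
  simp only [metric_eq]
  refine ((hasDerivAt_matrix_trace (hT hξ hη)).sub ((hasDerivAt_matrix_trace
    (hasDerivAt_matrix_mul (hasDerivAt_matrix_transpose (hT hX hξ)) (hT hX hη))).const_mul
      (1 - β))).congr_deriv ?_
  simp only [Matrix.transpose_add, Matrix.add_mul, Matrix.mul_add, Matrix.trace_add]
  ring

theorem metricDeriv_eq (X ζ ξ η : Matrix (Fin n) (Fin p) ℝ) :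
    metricDeriv β X ζ ξ η =
      -(1 - β) * ((ζᵀ * ξ)ᵀ * (Xᵀ * η) + (Xᵀ * ξ)ᵀ * (ζᵀ * η)).trace := by
  have smooth : ContDiff ℝ 1 (fun Z => metric β Z ξ η) := by
    have entry (i : Fin n) (j : Fin p) : ContDiff ℝ 1 fun Z : Matrix (Fin n) (Fin p) ℝ => Z i j :=
      contDiff_matrix.1 contDiff_id i j
    simp only [metric_eq, Matrix.trace, Matrix.mul_apply, Matrix.diag_apply,
      Matrix.transpose_apply]
    exact contDiff_const.sub (contDiff_const.mul (.sum fun i _ => .sum fun j _ =>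
      (ContDiff.sum fun k _ => (entry k j).mul contDiff_const).mul
        (ContDiff.sum fun k _ => (entry k j).mul contDiff_const)))
  have line : HasDerivAt (fun s : ℝ => X + s • ζ) ζ 0 := by
    rw [hasDerivAt_matrix]
    intro i j
    simpa using ((hasDerivAt_id (0 : ℝ)).mul_const (ζ i j)).const_add (X i j)
  have base : X + (0 : ℝ) • ζ = X := by simp
  have along_line :
      HasDerivAt (fun s : ℝ => metric β (X + s • ζ) ξ η) (metricDeriv β X ζ ξ η) 0 := by
    refine HasFDerivAt.comp_hasDerivAt (0 : ℝ) (l := fun Z => metric β Z ξ η) ?_ line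
    rw [base]
    exact (smooth.differentiable one_ne_zero X).hasFDerivAt
  rw [along_line.unique (hasDerivAt_metric β line (hasDerivAt_const 0 ξ) (hasDerivAt_const 0 η)),
    base]
  simp [metric_eq]
  ring

theorem covariantAcceleration_eq (γ : ℝ → Matrix (Fin n) (Fin p) ℝ) (t : ℝ)
    (η : Matrix (Fin n) (Fin p) ℝ) :
    covariantAcceleration β γ t η =
      ((deriv (deriv γ) t)ᵀ * η).trace - (1 - β) * (
        ((deriv (deriv γ) t)ᵀ * γ t * ((γ t)ᵀ * η)).trace
        + ((deriv γ t)ᵀ * deriv γ t * ((γ t)ᵀ * η)).trace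
        + ((deriv γ t)ᵀ * γ t * ((deriv γ t)ᵀ * η)).trace
        - ((deriv γ t)ᵀ * η * ((γ t)ᵀ * deriv γ t)).trace) := by
  have swap : ((deriv γ t)ᵀ * γ t * (ηᵀ * deriv γ t)).trace =
      ((deriv γ t)ᵀ * η * ((γ t)ᵀ * deriv γ t)).trace := by
    rw [← Matrix.trace_transpose]
    simp [Matrix.mul_assoc]
  simp only [covariantAcceleration, metric_eq, metricDeriv_eq, Matrix.transpose_mul,
    Matrix.transpose_transpose, Matrix.trace_add, swap]
  ring

end MetricFormulas

section Geodesics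

variable {n p : ℕ} {β : ℝ} {γ : ℝ → Matrix (Fin n) (Fin p) ℝ}

theorem deriv_mem_tangentSpace {ξ : Matrix (Fin n) (Fin p) ℝ} {t : ℝ}
    (hmem : ∀ᶠ s in nhds t, γ s ∈ manifold n p) (hξ : HasDerivAt γ ξ t) :
    ξ ∈ tangentSpace (γ t) := by
  have product_rule := hasDerivAt_matrix_mul (hasDerivAt_matrix_transpose hξ) hξ
  have constant : HasDerivAt (fun s => (γ s)ᵀ * γ s) 0 t :=
    (hasDerivAt_const t 1).congr_of_eventuallyEq hmem
  exact (add_comm _ _).trans (product_rule.unique constant)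

namespace IsGeodesic

theorem contDiff_one (hγ : IsGeodesic β γ) : ContDiff ℝ 1 γ :=
  hγ.1.of_le (by exact_mod_cast le_top)

theorem hasDerivAt (hγ : IsGeodesic β γ) (t : ℝ) : HasDerivAt γ (deriv γ t) t :=
  (hγ.1.differentiable (by simp) t).hasDerivAt

theorem hasDerivAt_deriv (hγ : IsGeodesic β γ) (t : ℝ) :
    HasDerivAt (deriv γ) (deriv (deriv γ) t) t :=
  ((contDiff_infty_iff_deriv.1 hγ.1).2.differentiable (by simp) t).hasDerivAt

theorem deriv_mem (hγ : IsGeodesic β γ) (t : ℝ) : deriv γ t ∈ tangentSpace (γ t) :=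
  deriv_mem_tangentSpace (.of_forall hγ.2.1) (hγ.hasDerivAt t)

theorem metric_deriv_eq (hγ : IsGeodesic β γ) (s t : ℝ) :
    metric β (γ s) (deriv γ s) (deriv γ s) = metric β (γ t) (deriv γ t) (deriv γ t) := by
  have hderiv (r : ℝ) :
      HasDerivAt (fun r => metric β (γ r) (deriv γ r) (deriv γ r)) 0 r := by
    have acceleration_zero := hγ.2.2 r _ (hγ.deriv_mem r)
    refine (hasDerivAt_metric β (hγ.hasDerivAt r) (hγ.hasDerivAt_deriv r)
      (hγ.hasDerivAt_deriv r)).congr_deriv ?_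
    rw [covariantAcceleration, metricDeriv_eq] at acceleration_zero
    rw [metric_comm β _ (deriv γ r)]
    linear_combination 2 * acceleration_zero
  exact is_const_of_deriv_eq_zero (fun r => (hderiv r).differentiableAt)
    (fun r => (hderiv r).deriv) s t

theorem injRadius_le (hγ : IsGeodesic β γ)
    (h1 : metric β (γ 0) (deriv γ 0) (deriv γ 0) = 1) : injRadius β n p ≤ cutTime β γ :=
  (iInf₂_le (γ 0) (hγ.2.1 0)).trans
    (iInf₂_le_of_le (deriv γ 0) ⟨hγ.deriv_mem 0, h1⟩ (iInf₂_le γ ⟨hγ, rfl, rfl⟩))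

end IsGeodesic

theorem le_injRadius {b : ℝ≥0∞} (h : ∀ γ : ℝ → Matrix (Fin n) (Fin p) ℝ, IsGeodesic β γ →
    (∀ t, metric β (γ t) (deriv γ t) (deriv γ t) = 1) → b ≤ cutTime β γ) :
    b ≤ injRadius β n p := by
  refine le_iInf₂ fun X _ => le_iInf₂ fun ξ hξ => le_iInf₂ fun γ ⟨hγ, hγX, hγξ⟩ =>
    h γ hγ fun t => ?_
  rw [hγ.metric_deriv_eq t 0, hγX, hγξ, hξ.2]

theorem speed_eq_one_of_metric_eq_one
    (h : ∀ t, metric β (γ t) (deriv γ t) (deriv γ t) = 1) (t : ℝ) : speed β γ t = 1 := by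
  rw [speed, h, Real.sqrt_one]

theorem trace_mul_eq_zero_of_symm_of_skew {E G : Matrix (Fin p) (Fin p) ℝ} (hE : Eᵀ = E)
    (hG : Gᵀ = -G) : (E * G).trace = 0 := by
  have h : (E * G).trace = -(E * G).trace := by
    conv_lhs => rw [← Matrix.trace_transpose, Matrix.transpose_mul, hE, hG, Matrix.trace_mul_comm]
    rw [Matrix.mul_neg, Matrix.trace_neg]
  linarith

theorem transpose_mul_skew {X η : Matrix (Fin n) (Fin p) ℝ} (h : η ∈ tangentSpace X) :
    (Xᵀ * η)ᵀ = -(Xᵀ * η) := by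
  rw [Matrix.transpose_mul, Matrix.transpose_transpose]
  exact eq_neg_of_add_eq_zero_right h

theorem isGeodesic_of_horizontal (hγ : ContDiff ℝ ∞ γ) (hmem : ∀ t, γ t ∈ manifold n p)
    {E : Matrix (Fin p) (Fin p) ℝ} (horizontal : ∀ t, (γ t)ᵀ * deriv γ t = 0)
    (gram : ∀ t, (deriv γ t)ᵀ * deriv γ t = E) (hderiv₂ : ∀ t, deriv (deriv γ) t = -(γ t * E)) :
    IsGeodesic β γ := by
  refine ⟨hγ, hmem, fun t η hη => ?_⟩
  have hX : (γ t)ᵀ * γ t = 1 := hmem t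
  have hE : Eᵀ = E := by rw [← gram t, Matrix.transpose_mul, Matrix.transpose_transpose]
  have horizontal' : (deriv γ t)ᵀ * γ t = 0 := by
    simpa using congrArg Matrix.transpose (horizontal t)
  have hderiv₂' : (deriv (deriv γ) t)ᵀ = -(E * (γ t)ᵀ) := by
    rw [hderiv₂, Matrix.transpose_neg, Matrix.transpose_mul, hE]
  rw [covariantAcceleration_eq, hderiv₂', gram, horizontal', horizontal]
  rw [Matrix.neg_mul, Matrix.neg_mul, Matrix.mul_assoc E, Matrix.mul_assoc E, hX]
  simp [trace_mul_eq_zero_of_symm_of_skew hE (transpose_mul_skew hη)]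

end Geodesics

/-- The affine map `Z ↦ Y Z Qᵀ + R`, used as an embedding of `St(m,q)` into `St(n,p)`: the frame
varies on the span of the columns of `Q` in `ℝᵖ`, with values in the span of the columns of `Y` in
`ℝⁿ`, and `R` is its fixed part. -/
def frameEmbedding {n p m q : ℕ} (Y : Matrix (Fin n) (Fin m) ℝ) (Q : Matrix (Fin p) (Fin q) ℝ)
    (R : Matrix (Fin n) (Fin p) ℝ) (Z : Matrix (Fin m) (Fin q) ℝ) : Matrix (Fin n) (Fin p) ℝ :=
  Y * Z * Qᵀ + R

/-- The relations under which `frameEmbedding Y Q R` is an isometric and totally geodesic embedding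
of `St(m,q)` into `St(n,p)`. -/
structure IsEmbedding {n p m q : ℕ} (Y : Matrix (Fin n) (Fin m) ℝ) (Q : Matrix (Fin p) (Fin q) ℝ)
    (R : Matrix (Fin n) (Fin p) ℝ) : Prop where
  transpose_mul_self_left : Yᵀ * Y = 1
  transpose_mul_self_right : Qᵀ * Q = 1
  transpose_mul_fixed : Yᵀ * R = 0
  fixed_mul : R * Q = 0
  fixed_transpose_mul_self : Rᵀ * R = 1 - Q * Qᵀ

theorem contDiff_frameEmbedding {n p m q : ℕ} (Y : Matrix (Fin n) (Fin m) ℝ)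
    (Q : Matrix (Fin p) (Fin q) ℝ) (R : Matrix (Fin n) (Fin p) ℝ) {k : WithTop ℕ∞} :
    ContDiff ℝ k (frameEmbedding Y Q R) :=
  (contDiff_matrix_mul (contDiff_matrix_mul contDiff_const contDiff_id) contDiff_const).add
    contDiff_const

theorem trace_conj_mul_of_mul_eq {n p m q : ℕ} {Y : Matrix (Fin n) (Fin m) ℝ}
    {Q : Matrix (Fin p) (Fin q) ℝ} {B : Matrix (Fin n) (Fin p) ℝ} {Z : Matrix (Fin m) (Fin q) ℝ}
    (hB : B * Q = Y * Z) (M : Matrix (Fin q) (Fin q) ℝ)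
    (η : Matrix (Fin n) (Fin p) ℝ) :
    (Q * M * Qᵀ * (Bᵀ * η)).trace = (M * (Zᵀ * (Yᵀ * η * Q))).trace := by
  have hB' : Qᵀ * Bᵀ = Zᵀ * Yᵀ := by simpa using congrArg Matrix.transpose hB
  calc (Q * M * Qᵀ * (Bᵀ * η)).trace = (Q * (M * (Qᵀ * Bᵀ) * η)).trace := by
        simp only [Matrix.mul_assoc]
    _ = (M * (Zᵀ * (Yᵀ * η * Q))).trace := by
        rw [hB', Matrix.trace_mul_comm]
        simp only [Matrix.mul_assoc]

namespace IsEmbedding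

variable {n p m q : ℕ} {Y : Matrix (Fin n) (Fin m) ℝ} {Q : Matrix (Fin p) (Fin q) ℝ}
  {R : Matrix (Fin n) (Fin p) ℝ}

theorem fixed_transpose_mul (h : IsEmbedding Y Q R) : Rᵀ * Y = 0 := by
  simpa using congrArg Matrix.transpose h.transpose_mul_fixed

theorem gram (h : IsEmbedding Y Q R) (ξ η : Matrix (Fin m) (Fin q) ℝ) :
    (Y * ξ * Qᵀ)ᵀ * (Y * η * Qᵀ) = Q * (ξᵀ * η) * Qᵀ :=
  calc (Y * ξ * Qᵀ)ᵀ * (Y * η * Qᵀ) = Q * ξᵀ * (Yᵀ * Y) * η * Qᵀ := by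
        simp only [Matrix.transpose_mul, Matrix.transpose_transpose, Matrix.mul_assoc]
    _ = Q * (ξᵀ * η) * Qᵀ := by
        rw [h.transpose_mul_self_left, Matrix.mul_one, Matrix.mul_assoc Q]

theorem transpose_mul (h : IsEmbedding Y Q R) (Z ξ : Matrix (Fin m) (Fin q) ℝ) :
    (frameEmbedding Y Q R Z)ᵀ * (Y * ξ * Qᵀ) = Q * (Zᵀ * ξ) * Qᵀ := by
  rw [frameEmbedding, Matrix.transpose_add, Matrix.add_mul, h.gram, Matrix.mul_assoc Y,
    ← Matrix.mul_assoc Rᵀ, h.fixed_transpose_mul, Matrix.zero_mul, add_zero]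

theorem trace_conj (h : IsEmbedding Y Q R) (M : Matrix (Fin q) (Fin q) ℝ) :
    (Q * M * Qᵀ).trace = M.trace := by
  rw [Matrix.mul_assoc, Matrix.trace_mul_comm, Matrix.mul_assoc, h.transpose_mul_self_right,
    Matrix.mul_one]

theorem mem_manifold (h : IsEmbedding Y Q R) {Z : Matrix (Fin m) (Fin q) ℝ}
    (hZ : Z ∈ manifold m q) : frameEmbedding Y Q R Z ∈ manifold n p := by
  have hZ : Zᵀ * Z = 1 := hZ
  have cross : (Y * Z * Qᵀ)ᵀ * R = 0 := by
    simp only [Matrix.transpose_mul, Matrix.mul_assoc, h.transpose_mul_fixed, Matrix.mul_zero]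
  change (frameEmbedding Y Q R Z)ᵀ * frameEmbedding Y Q R Z = 1
  rw [frameEmbedding, Matrix.mul_add, ← frameEmbedding, h.transpose_mul, hZ, frameEmbedding,
    Matrix.transpose_add, Matrix.add_mul, cross,
    h.fixed_transpose_mul_self, Matrix.mul_one, zero_add, add_sub_cancel]

theorem metric_eq (h : IsEmbedding Y Q R) (β : ℝ) (Z ξ η : Matrix (Fin m) (Fin q) ℝ) :
    metric β (frameEmbedding Y Q R Z) (Y * ξ * Qᵀ) (Y * η * Qᵀ) = metric β Z ξ η := by
  have conj (A B : Matrix (Fin q) (Fin q) ℝ) :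
      (Q * A * Qᵀ)ᵀ * (Q * B * Qᵀ) = Q * (Aᵀ * B) * Qᵀ :=
    calc (Q * A * Qᵀ)ᵀ * (Q * B * Qᵀ) = Q * Aᵀ * (Qᵀ * Q) * B * Qᵀ := by
          simp only [Matrix.transpose_mul, Matrix.transpose_transpose, Matrix.mul_assoc]
      _ = Q * (Aᵀ * B) * Qᵀ := by
          rw [h.transpose_mul_self_right, Matrix.mul_one, Matrix.mul_assoc Q]
  rw [Stiefel.metric_eq, Stiefel.metric_eq, h.gram, h.transpose_mul, h.transpose_mul, conj,
    h.trace_conj, h.trace_conj]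

theorem transpose_mul_mul_mul (h : IsEmbedding Y Q R) (ξ : Matrix (Fin m) (Fin q) ℝ) :
    Yᵀ * (Y * ξ * Qᵀ) * Q = ξ := by
  rw [Matrix.mul_assoc Y, ← Matrix.mul_assoc Yᵀ, h.transpose_mul_self_left, Matrix.one_mul,
    Matrix.mul_assoc, h.transpose_mul_self_right, Matrix.mul_one]

/-- No differentiability is needed: `c s = Yᵀ (Y (c s) Qᵀ) Q`, so the two curves are differentiable
at the same times. -/
theorem deriv_mul_mul (h : IsEmbedding Y Q R) (c : ℝ → Matrix (Fin m) (Fin q) ℝ) (t : ℝ) :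
    deriv (fun s => Y * c s * Qᵀ) t = Y * deriv c t * Qᵀ := by
  have conj {a b a' b' : ℕ} (A : Matrix (Fin a) (Fin b) ℝ) (B : Matrix (Fin a') (Fin b') ℝ)
      {f : ℝ → Matrix (Fin b) (Fin a') ℝ} {f' : Matrix (Fin b) (Fin a') ℝ}
      (hf : HasDerivAt f f' t) : HasDerivAt (fun s => A * f s * B) (A * f' * B) t :=
    (hasDerivAt_matrix_mul (hasDerivAt_matrix_mul (hasDerivAt_const t A) hf)
      (hasDerivAt_const t B)).congr_deriv (by simp)
  by_cases hc : DifferentiableAt ℝ c t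
  · exact (conj Y Qᵀ hc.hasDerivAt).deriv
  · have image_not_differentiable : ¬ DifferentiableAt ℝ (fun s => Y * c s * Qᵀ) t := by
      refine fun hd => hc ?_
      have := (conj Yᵀ Q hd.hasDerivAt).differentiableAt
      simp only [h.transpose_mul_mul_mul] at this
      exact this
    have hzero : deriv c t = 0 := deriv_zero_of_not_differentiableAt hc
    rw [hzero, Matrix.mul_zero, Matrix.zero_mul]
    exact deriv_zero_of_not_differentiableAt image_not_differentiable

theorem deriv_comp (h : IsEmbedding Y Q R) (c : ℝ → Matrix (Fin m) (Fin q) ℝ) :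
    deriv (fun s => frameEmbedding Y Q R (c s)) = fun s => Y * deriv c s * Qᵀ :=
  funext fun t => (deriv_add_const R).trans (h.deriv_mul_mul c t)

theorem speed_comp (h : IsEmbedding Y Q R) (β : ℝ) (c : ℝ → Matrix (Fin m) (Fin q) ℝ) (t : ℝ) :
    speed β (fun s => frameEmbedding Y Q R (c s)) t = speed β c t := by
  rw [speed, speed, h.deriv_comp, h.metric_eq]

theorem isPiecewiseC1Curve_comp (h : IsEmbedding Y Q R) {c : ℝ → Matrix (Fin m) (Fin q) ℝ}
    (hc : IsPiecewiseC1Curve c) : IsPiecewiseC1Curve fun s => frameEmbedding Y Q R (c s) := by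
  obtain ⟨hcont, hmem, S, hS⟩ := hc
  exact ⟨(contDiff_frameEmbedding Y Q R (k := 1)).continuous.comp_continuousOn hcont,
    fun t ht => h.mem_manifold (hmem t ht), S, fun a b ha hab hb hSab =>
      (contDiff_frameEmbedding Y Q R).comp_contDiffOn (hS a b ha hab hb hSab)⟩

theorem riemannianDist_le (h : IsEmbedding Y Q R) (β : ℝ) (Z W : Matrix (Fin m) (Fin q) ℝ) :
    riemannianDist β (frameEmbedding Y Q R Z) (frameEmbedding Y Q R W) ≤ riemannianDist β Z W := by
  refine le_iInf₂ fun c ⟨hc, h0, h1⟩ => ?_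
  have length_eq : curveLength β (fun s => frameEmbedding Y Q R (c s)) = curveLength β c :=
    intervalIntegral.integral_congr fun t _ => h.speed_comp β c t
  rw [← length_eq]
  exact iInf₂_le (fun s => frameEmbedding Y Q R (c s))
    ⟨h.isPiecewiseC1Curve_comp hc, congrArg _ h0, congrArg _ h1⟩

theorem cutTime_comp_le (h : IsEmbedding Y Q R) {β : ℝ} {γ : ℝ → Matrix (Fin m) (Fin q) ℝ}
    (hγ : ContDiff ℝ 1 γ) (hmem : ∀ t, γ t ∈ manifold m q) (hs : ∀ t, speed β γ t = 1) :
    cutTime β (fun t => frameEmbedding Y Q R (γ t)) ≤ cutTime β γ := by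
  refine iSup₂_le fun t ⟨ht0, ht⟩ => le_iSup₂_of_le t ⟨ht0, le_antisymm ?_ ?_⟩ le_rfl
  · simpa [abs_of_pos ht0] using riemannianDist_le_of_speed_eq hγ hmem hs 0 t
  · exact ht.symm.trans_le (h.riemannianDist_le β _ _)

theorem frameEmbedding_mul (h : IsEmbedding Y Q R) (Z : Matrix (Fin m) (Fin q) ℝ) :
    frameEmbedding Y Q R Z * Q = Y * Z := by
  rw [frameEmbedding, Matrix.add_mul, h.fixed_mul, add_zero, Matrix.mul_assoc,
    h.transpose_mul_self_right, Matrix.mul_one]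

theorem transpose_mul_mul_mem_tangentSpace (h : IsEmbedding Y Q R) {Z : Matrix (Fin m) (Fin q) ℝ}
    {η : Matrix (Fin n) (Fin p) ℝ} (hη : η ∈ tangentSpace (frameEmbedding Y Q R Z)) :
    Yᵀ * η * Q ∈ tangentSpace Z := by
  have hη : (frameEmbedding Y Q R Z)ᵀ * η + ηᵀ * frameEmbedding Y Q R Z = 0 := hη
  have frame_mul := h.frameEmbedding_mul Z
  have transpose_mul_frame : Qᵀ * (frameEmbedding Y Q R Z)ᵀ = Zᵀ * Yᵀ := by
    simpa using congrArg Matrix.transpose frame_mul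
  calc Zᵀ * (Yᵀ * η * Q) + (Yᵀ * η * Q)ᵀ * Z = Zᵀ * Yᵀ * η * Q + Qᵀ * ηᵀ * (Y * Z) := by
        simp only [Matrix.transpose_mul, Matrix.transpose_transpose, Matrix.mul_assoc]
    _ = Qᵀ * ((frameEmbedding Y Q R Z)ᵀ * η + ηᵀ * frameEmbedding Y Q R Z) * Q := by
        rw [← transpose_mul_frame, ← frame_mul]
        simp only [Matrix.mul_add, Matrix.add_mul, Matrix.mul_assoc]
    _ = 0 := by rw [hη, Matrix.mul_zero, Matrix.zero_mul]

theorem covariantAcceleration_comp (h : IsEmbedding Y Q R) (β : ℝ)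
    (γ : ℝ → Matrix (Fin m) (Fin q) ℝ) (t : ℝ) (η : Matrix (Fin n) (Fin p) ℝ) :
    covariantAcceleration β (fun s => frameEmbedding Y Q R (γ s)) t η =
      covariantAcceleration β γ t (Yᵀ * η * Q) := by
  have tangent_mul (V : Matrix (Fin m) (Fin q) ℝ) : Y * V * Qᵀ * Q = Y * V := by
    rw [Matrix.mul_assoc, h.transpose_mul_self_right, Matrix.mul_one]
  have transpose_mul' (V Z : Matrix (Fin m) (Fin q) ℝ) :
      (Y * V * Qᵀ)ᵀ * frameEmbedding Y Q R Z = Q * (Vᵀ * Z) * Qᵀ := by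
    simpa [Matrix.mul_assoc] using congrArg Matrix.transpose (h.transpose_mul Z V)
  have trace_linear (V : Matrix (Fin m) (Fin q) ℝ) :
      ((Y * V * Qᵀ)ᵀ * η).trace = (Vᵀ * (Yᵀ * η * Q)).trace := by
    rw [Matrix.transpose_mul, Matrix.transpose_transpose, Matrix.mul_assoc, Matrix.trace_mul_comm]
    simp only [Matrix.transpose_mul, Matrix.mul_assoc]
  have trace_last (V Z : Matrix (Fin m) (Fin q) ℝ) :
      ((Y * V * Qᵀ)ᵀ * η * (Q * (Zᵀ * V) * Qᵀ)).trace =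
        (Vᵀ * (Yᵀ * η * Q) * (Zᵀ * V)).trace := by
    rw [← h.trace_conj]
    simp only [Matrix.transpose_mul, Matrix.transpose_transpose, Matrix.mul_assoc]
  rw [covariantAcceleration_eq, covariantAcceleration_eq, h.deriv_comp, h.deriv_mul_mul,
    transpose_mul', transpose_mul', h.gram, h.transpose_mul, trace_linear, trace_last,
    trace_conj_mul_of_mul_eq (h.frameEmbedding_mul _),
    trace_conj_mul_of_mul_eq (h.frameEmbedding_mul _),
    trace_conj_mul_of_mul_eq (tangent_mul _)]

theorem isGeodesic_comp (h : IsEmbedding Y Q R) {β : ℝ} {γ : ℝ → Matrix (Fin m) (Fin q) ℝ}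
    (hγ : IsGeodesic β γ) : IsGeodesic β fun s => frameEmbedding Y Q R (γ s) :=
  ⟨(contDiff_frameEmbedding Y Q R).comp hγ.1, fun t => h.mem_manifold (hγ.2.1 t), fun t η hη => by
    rw [h.covariantAcceleration_comp]
    exact hγ.2.2 t _ (h.transpose_mul_mul_mem_tangentSpace hη)⟩

theorem injRadius_le (h : IsEmbedding Y Q R) (β : ℝ) : injRadius β n p ≤ injRadius β m q := by
  refine le_injRadius fun γ hγ hunit => ?_
  have hunit_image : metric β (frameEmbedding Y Q R (γ 0))
      (deriv (fun s => frameEmbedding Y Q R (γ s)) 0)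
      (deriv (fun s => frameEmbedding Y Q R (γ s)) 0) = 1 := by
    rw [h.deriv_comp, h.metric_eq, hunit]
  exact ((h.isGeodesic_comp hγ).injRadius_le hunit_image).trans
    (h.cutTime_comp_le hγ.contDiff_one hγ.2.1 (speed_eq_one_of_metric_eq_one hunit))

end IsEmbedding

section Inclusion

/-- The matrix of the isometry `ℝᵏ → ℝᵐ` that permutes the standard basis vectors along `f`. -/
def inclusion {k m : ℕ} (f : Fin k → Fin m) : Matrix (Fin m) (Fin k) ℝ :=
  (1 : Matrix (Fin m) (Fin m) ℝ).submatrix id f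

theorem inclusion_transpose_mul {k l m : ℕ} (f : Fin k → Fin m) (g : Fin l → Fin m) :
    (inclusion f)ᵀ * inclusion g = (1 : Matrix (Fin m) (Fin m) ℝ).submatrix f g := by
  ext i j
  simp [inclusion, Matrix.mul_apply, Matrix.one_apply]

theorem inclusion_transpose_mul_self {k m : ℕ} {f : Fin k → Fin m} (hf : Function.Injective f) :
    (inclusion f)ᵀ * inclusion f = 1 := by
  rw [inclusion_transpose_mul, Matrix.submatrix_one f hf]

theorem inclusion_transpose_mul_eq_zero {k l m : ℕ} {f : Fin k → Fin m} {g : Fin l → Fin m}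
    (hfg : ∀ i j, f i ≠ g j) : (inclusion f)ᵀ * inclusion g = 0 := by
  rw [inclusion_transpose_mul]
  ext i j
  exact Matrix.one_apply_ne (hfg i j)

theorem inclusion_castAdd_mul_add_inclusion_natAdd_mul (q k : ℕ) :
    inclusion (fun j : Fin q => Fin.castAdd k j) * (inclusion fun j : Fin q => Fin.castAdd k j)ᵀ +
      inclusion (fun j : Fin k => Fin.natAdd q j) * (inclusion fun j : Fin k => Fin.natAdd q j)ᵀ =
        1 := by
  have split_sum := Matrix.mul_one (1 : Matrix (Fin (q + k)) (Fin (q + k)) ℝ)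
  ext i j
  rw [← split_sum, Matrix.mul_apply, Fin.sum_univ_add, Matrix.add_apply, Matrix.mul_apply,
    Matrix.mul_apply]
  simp [inclusion, Matrix.one_apply, eq_comm]

theorem isEmbedding_inclusion (m q k l : ℕ) :
    IsEmbedding (inclusion fun i : Fin m => Fin.castAdd l (Fin.castAdd k i))
      (inclusion fun j : Fin q => Fin.castAdd k j)
      (inclusion (fun i : Fin k => Fin.castAdd l (Fin.natAdd m i)) *
        (inclusion fun j : Fin k => Fin.natAdd q j)ᵀ) where
  transpose_mul_self_left := inclusion_transpose_mul_self <|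
    (Fin.castAdd_injective _ l).comp (Fin.castAdd_injective m k)
  transpose_mul_self_right := inclusion_transpose_mul_self (Fin.castAdd_injective q k)
  transpose_mul_fixed := by
    rw [← Matrix.mul_assoc, inclusion_transpose_mul_eq_zero, Matrix.zero_mul]
    intro i j h
    simp [Fin.ext_iff] at h
    omega
  fixed_mul := by
    rw [Matrix.mul_assoc, inclusion_transpose_mul_eq_zero, Matrix.mul_zero]
    intro i j h
    simp [Fin.ext_iff] at h
    omega
  fixed_transpose_mul_self := by
    rw [Matrix.transpose_mul, Matrix.transpose_transpose, Matrix.mul_assoc,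
      ← Matrix.mul_assoc _ _ (inclusion _)ᵀ, inclusion_transpose_mul_self, Matrix.one_mul]
    · exact eq_sub_of_add_eq' (inclusion_castAdd_mul_add_inclusion_natAdd_mul q k)
    · exact (Fin.castAdd_injective _ l).comp (Fin.natAdd_injective k m)

theorem injRadius_antitone (β : ℝ) {n p m q : ℕ} (hq : q ≤ p) (hcodim : m + p ≤ n + q) :
    injRadius β n p ≤ injRadius β m q := by
  obtain ⟨k, rfl⟩ := Nat.exists_eq_add_of_le hq
  obtain ⟨l, rfl⟩ : ∃ l, n = m + k + l := ⟨n - (m + k), by omega⟩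
  exact (isEmbedding_inclusion m q k l).injRadius_le β

end Inclusion

section GreatCircle

variable {n p : ℕ} {X N : Matrix (Fin n) (Fin p) ℝ}

/-- The curve `t ↦ cos(kt) X + sin(kt) N` that rotates the frame `X` into the frame `N`. -/
def greatCircle (X N : Matrix (Fin n) (Fin p) ℝ) (k t : ℝ) : Matrix (Fin n) (Fin p) ℝ :=
  Real.cos (k * t) • X + Real.sin (k * t) • N

theorem contDiff_greatCircle (X N : Matrix (Fin n) (Fin p) ℝ) (k : ℝ) {r : WithTop ℕ∞} :
    ContDiff ℝ r (greatCircle X N k) := by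
  unfold greatCircle
  fun_prop

theorem deriv_greatCircle (X N : Matrix (Fin n) (Fin p) ℝ) (k : ℝ) :
    deriv (greatCircle X N k) = fun t => k • greatCircle N (-X) k t := by
  funext t
  have hk : HasDerivAt (fun t => k * t) k t := by simpa using (hasDerivAt_id t).const_mul k
  refine HasDerivAt.deriv (((hk.cos.smul_const X).add (hk.sin.smul_const N)).congr_deriv ?_)
  simp only [greatCircle]
  module

theorem deriv_deriv_greatCircle (X N : Matrix (Fin n) (Fin p) ℝ) (k t : ℝ) :
    deriv (deriv (greatCircle X N k)) t = -(k ^ 2) • greatCircle X N k t := by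
  have hderiv : deriv (fun s => k • greatCircle N (-X) k s) t =
      k • deriv (greatCircle N (-X) k) t :=
    deriv_const_smul k
      ((contDiff_greatCircle N (-X) k (r := 1)).differentiable one_ne_zero t)
  rw [deriv_greatCircle, hderiv, deriv_greatCircle]
  simp only [greatCircle]
  module

theorem greatCircle_mem (hX : Xᵀ * X = 1) (hN : Nᵀ * N = 1) (hXN : Xᵀ * N = 0) (k t : ℝ) :
    greatCircle X N k t ∈ manifold n p := by
  have hNX : Nᵀ * X = 0 := by simpa using congrArg Matrix.transpose hXN
  change (greatCircle X N k t)ᵀ * greatCircle X N k t = 1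
  simp only [greatCircle, Matrix.transpose_add, Matrix.transpose_smul, Matrix.add_mul,
    Matrix.mul_add, Matrix.smul_mul, Matrix.mul_smul, hX, hN, hXN, hNX, smul_zero, add_zero,
    zero_add, smul_smul, ← add_smul]
  rw [← sq, ← sq, Real.cos_sq_add_sin_sq, one_smul]

theorem greatCircle_transpose_mul_deriv (hX : Xᵀ * X = 1) (hN : Nᵀ * N = 1) (hXN : Xᵀ * N = 0)
    (k t : ℝ) : (greatCircle X N k t)ᵀ * deriv (greatCircle X N k) t = 0 := by
  have hNX : Nᵀ * X = 0 := by simpa using congrArg Matrix.transpose hXN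
  rw [deriv_greatCircle]
  simp only [greatCircle, Matrix.transpose_add, Matrix.transpose_smul, Matrix.add_mul,
    Matrix.mul_add, Matrix.smul_mul, Matrix.mul_smul, Matrix.mul_neg, hX, hN, hXN, hNX]
  module

theorem deriv_greatCircle_transpose_mul_deriv (hX : Xᵀ * X = 1) (hN : Nᵀ * N = 1)
    (hXN : Xᵀ * N = 0) (k t : ℝ) :
    (deriv (greatCircle X N k) t)ᵀ * deriv (greatCircle X N k) t = k ^ 2 • 1 := by
  have hNX : Nᵀ * -X = 0 := by simpa using congrArg Matrix.transpose hXN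
  have velocity_mem : (greatCircle N (-X) k t)ᵀ * greatCircle N (-X) k t = 1 :=
    greatCircle_mem hN (by simpa using hX) hNX k t
  rw [deriv_greatCircle, Matrix.transpose_smul, Matrix.smul_mul, Matrix.mul_smul, velocity_mem,
    smul_smul, sq]

theorem isGeodesic_greatCircle (hX : Xᵀ * X = 1) (hN : Nᵀ * N = 1) (hXN : Xᵀ * N = 0)
    (β k : ℝ) : IsGeodesic β (greatCircle X N k) :=
  isGeodesic_of_horizontal (contDiff_greatCircle X N k) (greatCircle_mem hX hN hXN k)
    (greatCircle_transpose_mul_deriv hX hN hXN k)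
    (deriv_greatCircle_transpose_mul_deriv hX hN hXN k) fun t => by
      rw [deriv_deriv_greatCircle, Matrix.mul_smul, Matrix.mul_one, neg_smul]

theorem metric_deriv_greatCircle (hX : Xᵀ * X = 1) (hN : Nᵀ * N = 1) (hXN : Xᵀ * N = 0)
    (β k t : ℝ) :
    metric β (greatCircle X N k t) (deriv (greatCircle X N k) t) (deriv (greatCircle X N k) t) =
      k ^ 2 * p := by
  rw [metric_eq, greatCircle_transpose_mul_deriv hX hN hXN,
    deriv_greatCircle_transpose_mul_deriv hX hN hXN]
  simp

end GreatCircle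

theorem injRadius_circle_le (β : ℝ) : injRadius β 2 1 ≤ ENNReal.ofReal Real.pi := by
  let X : Matrix (Fin 2) (Fin 1) ℝ := !![1; 0]
  let N : Matrix (Fin 2) (Fin 1) ℝ := !![0; 1]
  have hX : Xᵀ * X = 1 := by ext i j; fin_cases i; fin_cases j; simp [X, Matrix.mul_apply]
  have hN : Nᵀ * N = 1 := by ext i j; fin_cases i; fin_cases j; simp [N, Matrix.mul_apply]
  have hXN : Xᵀ * N = 0 := by ext i j; simp [X, N, Matrix.mul_apply]
  have hmetric (t : ℝ) := metric_deriv_greatCircle hX hN hXN β 1 t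
  norm_num at hmetric
  have hspeed := speed_eq_one_of_metric_eq_one hmetric
  have hsmooth : ContDiff ℝ 1 (greatCircle X N 1) := contDiff_greatCircle X N 1
  have hmem := greatCircle_mem hX hN hXN 1
  refine ((isGeodesic_greatCircle hX hN hXN β 1).injRadius_le (hmetric 0)).trans
    (cutTime_le_of_forall_gt hsmooth hmem hspeed fun b hb => ?_)
  have pi_lt_two_pi : Real.pi < 2 * Real.pi := by linarith [Real.pi_pos]
  obtain ⟨t, htpi, ht⟩ := exists_between (lt_min hb pi_lt_two_pi)
  rw [lt_min_iff] at ht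
  have closed : greatCircle X N 1 (2 * Real.pi) = greatCircle X N 1 0 := by simp [greatCircle]
  refine ⟨t, ht.1, ?_⟩
  calc riemannianDist β (greatCircle X N 1 0) (greatCircle X N 1 t)
      ≤ ENNReal.ofReal (|t - 2 * Real.pi| * 1) :=
        closed ▸ riemannianDist_le_of_speed_eq hsmooth hmem hspeed (2 * Real.pi) t
    _ < ENNReal.ofReal t := by
        rw [ENNReal.ofReal_lt_ofReal_iff (Real.pi_pos.trans htpi), abs_of_neg (by linarith)]
        linarith

theorem injRadius_le_pi {n p : ℕ} (hp : 1 ≤ p) (hn : p + 1 ≤ n) (β : ℝ) :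
    injRadius β n p ≤ ENNReal.ofReal Real.pi :=
  (injRadius_antitone β hp (by omega)).trans (injRadius_circle_le β)

section BergerSphere

/-- The frame `(x, Jx)` in `ℝ⁴ = ℂ²`, where `J` is multiplication by `i`. The unit vectors `x` give
a three-sphere in `St(4,2)`, on which the metrics restrict to those of the Berger spheres. -/
def bergerFrame (x : Fin 4 → ℝ) : Matrix (Fin 4) (Fin 2) ℝ :=
  !![x 0, -x 1; x 1, x 0; x 2, -x 3; x 3, x 2]

/-- The Kähler form `⟨Jx, y⟩` of `ℝ⁴ = ℂ²`. -/
def kahlerForm (x y : Fin 4 → ℝ) : ℝ :=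
  x 0 * y 1 - x 1 * y 0 + x 2 * y 3 - x 3 * y 2

theorem bergerFrame_transpose_mul (x y : Fin 4 → ℝ) :
    (bergerFrame x)ᵀ * bergerFrame y =
      !![x ⬝ᵥ y, -kahlerForm x y; kahlerForm x y, x ⬝ᵥ y] := by
  ext i j
  fin_cases i <;> fin_cases j <;>
    simp [bergerFrame, kahlerForm, Matrix.mul_apply, dotProduct, Fin.sum_univ_four] <;> ring

theorem bergerFrame_mem {x : Fin 4 → ℝ} (hx : x ⬝ᵥ x = 1) : bergerFrame x ∈ manifold 4 2 := by
  have kahlerForm_self : kahlerForm x x = 0 := by rw [kahlerForm]; ring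
  change (bergerFrame x)ᵀ * bergerFrame x = 1
  rw [bergerFrame_transpose_mul, hx, kahlerForm_self, neg_zero, Matrix.one_fin_two]

theorem metric_bergerFrame (β : ℝ) (x y : Fin 4 → ℝ) :
    metric β (bergerFrame x) (bergerFrame y) (bergerFrame y) =
      2 * (y ⬝ᵥ y - (1 - β) * ((x ⬝ᵥ y) ^ 2 + kahlerForm x y ^ 2)) := by
  simp only [metric_eq, bergerFrame_transpose_mul, Matrix.trace_fin_two, Matrix.mul_apply,
    Fin.sum_univ_two, Matrix.transpose_apply, Matrix.of_apply, Matrix.cons_val]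
  ring

theorem hasDerivAt_bergerFrame {x : ℝ → Fin 4 → ℝ} {y : Fin 4 → ℝ} {t : ℝ}
    (hx : HasDerivAt x y t) : HasDerivAt (fun s => bergerFrame (x s)) (bergerFrame y) t := by
  have hcoord := hasDerivAt_pi.1 hx
  rw [hasDerivAt_matrix]
  intro i j
  fin_cases i <;> fin_cases j <;>
    simpa [bergerFrame] using by first | exact hcoord _ | exact (hcoord _).neg

theorem contDiff_bergerFrame {k : WithTop ℕ∞} : ContDiff ℝ k bergerFrame := by
  have hcoord (i : Fin 4) : ContDiff ℝ k fun x : Fin 4 → ℝ => x i := contDiff_apply ℝ ℝ i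
  rw [contDiff_matrix]
  intro i j
  fin_cases i <;> fin_cases j <;> first | exact hcoord _ | exact (hcoord _).neg

end BergerSphere

section BergerOrbit

open Real

/-- The orbit of a one-parameter group of isometries of the Berger sphere; in the coordinates of
`ℂ²`, `t ↦ (exp(iκt) (cos νt + i a sin νt), c exp(iκ(t - 1)) sin νt)`. -/
def bergerOrbit (κ ν a c t : ℝ) : Fin 4 → ℝ :=
  ![cos (κ * t) * cos (ν * t) - a * (sin (κ * t) * sin (ν * t)),
    sin (κ * t) * cos (ν * t) + a * (cos (κ * t) * sin (ν * t)),
    c * (sin (ν * t) * cos (κ * (t - 1))),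
    c * (sin (ν * t) * sin (κ * (t - 1)))]

/-- The derivative of `bergerOrbit`. -/
def bergerOrbitDeriv (κ ν a c t : ℝ) : Fin 4 → ℝ :=
  ![-((κ + a * ν) * (sin (κ * t) * cos (ν * t))) - (ν + a * κ) * (cos (κ * t) * sin (ν * t)),
    (κ + a * ν) * (cos (κ * t) * cos (ν * t)) - (ν + a * κ) * (sin (κ * t) * sin (ν * t)),
    c * (ν * (cos (ν * t) * cos (κ * (t - 1))) - κ * (sin (ν * t) * sin (κ * (t - 1)))),
    c * (ν * (cos (ν * t) * sin (κ * (t - 1))) + κ * (sin (ν * t) * cos (κ * (t - 1))))]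

/-- Half the squared speed of `bergerOrbit` in the canonical metric. -/
def bergerEnergy (κ ν a : ℝ) : ℝ :=
  ν ^ 2 + κ ^ 2 / 2 + κ * (a * ν) - (a * ν) ^ 2 / 2

variable {κ ν a c : ℝ}

theorem contDiff_bergerOrbit {k : WithTop ℕ∞} : ContDiff ℝ k (bergerOrbit κ ν a c) := by
  have hcos (b : ℝ) : ContDiff ℝ k fun t => cos (b * t) := by fun_prop
  have hsin (b : ℝ) : ContDiff ℝ k fun t => sin (b * t) := by fun_prop
  have hshift : ContDiff ℝ k fun t : ℝ => κ * (t - 1) := by fun_prop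
  rw [contDiff_pi]
  intro i
  fin_cases i
  · exact ((hcos κ).mul (hcos ν)).sub (contDiff_const.mul ((hsin κ).mul (hsin ν)))
  · exact ((hsin κ).mul (hcos ν)).add (contDiff_const.mul ((hcos κ).mul (hsin ν)))
  · exact contDiff_const.mul ((hsin ν).mul hshift.cos)
  · exact contDiff_const.mul ((hsin ν).mul hshift.sin)

theorem hasDerivAt_bergerOrbit (κ ν a c t : ℝ) :
    HasDerivAt (bergerOrbit κ ν a c) (bergerOrbitDeriv κ ν a c t) t := by
  have hκ : HasDerivAt (fun s => κ * s) κ t := by simpa using (hasDerivAt_id t).const_mul κ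
  have hν : HasDerivAt (fun s => ν * s) ν t := by simpa using (hasDerivAt_id t).const_mul ν
  have hκ' : HasDerivAt (fun s => κ * (s - 1)) κ t := by
    simpa using ((hasDerivAt_id t).sub_const 1).const_mul κ
  rw [hasDerivAt_pi]
  intro i
  fin_cases i
  · exact ((hκ.cos.mul hν.cos).sub ((hκ.sin.mul hν.sin).const_mul a)).congr_deriv
      (by simp only [bergerOrbitDeriv, Fin.zero_eta, Matrix.cons_val]; ring)
  · exact ((hκ.sin.mul hν.cos).add ((hκ.cos.mul hν.sin).const_mul a)).congr_deriv
      (by simp only [bergerOrbitDeriv, Fin.mk_one, Matrix.cons_val]; ring)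
  · exact ((hν.sin.mul hκ'.cos).const_mul c).congr_deriv
      (by simp only [bergerOrbitDeriv, Fin.reduceFinMk, Matrix.cons_val]; ring)
  · exact ((hν.sin.mul hκ'.sin).const_mul c).congr_deriv
      (by simp only [bergerOrbitDeriv, Fin.reduceFinMk, Matrix.cons_val]; ring)

theorem bergerOrbit_dotProduct_self (hac : a ^ 2 + c ^ 2 = 1) (t : ℝ) :
    bergerOrbit κ ν a c t ⬝ᵥ bergerOrbit κ ν a c t = 1 := by
  simp only [bergerOrbit, dotProduct, Fin.sum_univ_four, Matrix.cons_val]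
  linear_combination
    (cos (ν * t) ^ 2 + a ^ 2 * sin (ν * t) ^ 2) * sin_sq_add_cos_sq (κ * t) +
      c ^ 2 * sin (ν * t) ^ 2 * sin_sq_add_cos_sq (κ * (t - 1)) + sin (ν * t) ^ 2 * hac +
      sin_sq_add_cos_sq (ν * t)

theorem bergerOrbit_dotProduct_deriv (hac : a ^ 2 + c ^ 2 = 1) (t : ℝ) :
    bergerOrbit κ ν a c t ⬝ᵥ bergerOrbitDeriv κ ν a c t = 0 := by
  simp only [bergerOrbit, bergerOrbitDeriv, dotProduct, Fin.sum_univ_four, Matrix.cons_val]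
  linear_combination ν * sin (ν * t) * cos (ν * t) *
    ((a ^ 2 - 1) * sin_sq_add_cos_sq (κ * t) + c ^ 2 * sin_sq_add_cos_sq (κ * (t - 1)) + hac)

theorem kahlerForm_bergerOrbit_deriv (hac : a ^ 2 + c ^ 2 = 1) (t : ℝ) :
    kahlerForm (bergerOrbit κ ν a c t) (bergerOrbitDeriv κ ν a c t) = κ + a * ν := by
  simp only [bergerOrbit, bergerOrbitDeriv, kahlerForm, Matrix.cons_val]
  linear_combination
    (κ * (cos (ν * t) ^ 2 + a ^ 2 * sin (ν * t) ^ 2) +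
      a * ν * (sin (ν * t) ^ 2 + cos (ν * t) ^ 2)) * sin_sq_add_cos_sq (κ * t) +
      κ * c ^ 2 * sin (ν * t) ^ 2 * sin_sq_add_cos_sq (κ * (t - 1)) + κ * sin (ν * t) ^ 2 * hac +
      (κ + a * ν) * sin_sq_add_cos_sq (ν * t)

theorem bergerOrbitDeriv_dotProduct_self (hac : a ^ 2 + c ^ 2 = 1) (t : ℝ) :
    bergerOrbitDeriv κ ν a c t ⬝ᵥ bergerOrbitDeriv κ ν a c t =
      κ ^ 2 + ν ^ 2 + 2 * κ * (a * ν) := by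
  simp only [bergerOrbitDeriv, dotProduct, Fin.sum_univ_four, Matrix.cons_val]
  linear_combination
    (κ ^ 2 * (cos (ν * t) ^ 2 + a ^ 2 * sin (ν * t) ^ 2) +
      ν ^ 2 * (sin (ν * t) ^ 2 + a ^ 2 * cos (ν * t) ^ 2) +
      2 * κ * a * ν * (sin (ν * t) ^ 2 + cos (ν * t) ^ 2)) * sin_sq_add_cos_sq (κ * t) +
      c ^ 2 * (κ ^ 2 * sin (ν * t) ^ 2 + ν ^ 2 * cos (ν * t) ^ 2) *
        sin_sq_add_cos_sq (κ * (t - 1)) +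
      (κ ^ 2 * sin (ν * t) ^ 2 + ν ^ 2 * cos (ν * t) ^ 2) * hac +
      (κ ^ 2 + ν ^ 2 + 2 * κ * a * ν) * sin_sq_add_cos_sq (ν * t)

theorem speed_bergerOrbit (hac : a ^ 2 + c ^ 2 = 1) (t : ℝ) :
    speed (1 / 2) (fun s => bergerFrame (bergerOrbit κ ν a c s)) t =
      √(2 * bergerEnergy κ ν a) := by
  have hderiv : deriv (fun s => bergerFrame (bergerOrbit κ ν a c s)) t =
      bergerFrame (bergerOrbitDeriv κ ν a c t) :=
    (hasDerivAt_bergerFrame (hasDerivAt_bergerOrbit κ ν a c t)).deriv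
  rw [speed, hderiv, metric_bergerFrame, bergerOrbitDeriv_dotProduct_self hac,
    bergerOrbit_dotProduct_deriv hac, kahlerForm_bergerOrbit_deriv hac, bergerEnergy]
  ring_nf

theorem bergerOrbit_zero : bergerOrbit κ ν a c 0 = ![1, 0, 0, 0] := by
  simp [bergerOrbit]

variable {θ : ℝ}

theorem exists_bergerOrbit_one_eq (hsin : 0 < sin ν) (hcos : cos ν = cos θ * cos κ) :
    ∃ c, (-(sin κ * cos θ) / sin ν) ^ 2 + c ^ 2 = 1 ∧
      bergerOrbit κ ν (-(sin κ * cos θ) / sin ν) c 1 = ![cos θ, 0, sin θ, 0] := by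
  have hκ := sin_sq_add_cos_sq κ
  have hsin_sq : sin ν ^ 2 = 1 - (cos θ * cos κ) ^ 2 := by rw [sin_sq, hcos]
  refine ⟨sin θ / sin ν, ?_, ?_⟩
  · rw [div_pow, div_pow, ← add_div, div_eq_one_iff_eq (by positivity), hsin_sq]
    linear_combination sin_sq_add_cos_sq θ + cos θ ^ 2 * hκ
  · have hfirst : cos κ * cos ν - -(sin κ * cos θ) / sin ν * (sin κ * sin ν) = cos θ := by
      rw [hcos]
      field_simp
      linear_combination cos θ * hκ
    have hsecond : sin κ * cos ν + -(sin κ * cos θ) / sin ν * (cos κ * sin ν) = 0 := by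
      rw [hcos]
      field_simp
      ring
    simp [bergerOrbit, hfirst, hsecond, hsin.ne']

theorem hasDerivAt_arccos_mul_one_sub_sq (hθ : θ ∈ Set.Ioo 0 π) :
    HasDerivAt (fun x => arccos (cos θ * (1 - x)) ^ 2) (2 * (θ * cos θ / sin θ)) 0 := by
  have hsin : 0 < sin θ := sin_pos_of_mem_Ioo hθ
  have inner : HasDerivAt (fun x : ℝ => cos θ * (1 - x)) (-cos θ) 0 := by
    simpa using ((hasDerivAt_id (0 : ℝ)).const_sub 1).const_mul (cos θ)
  have outer : HasDerivAt arccos (-(1 / √(1 - cos θ ^ 2))) (cos θ * (1 - 0)) := by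
    have cos_sq_lt : cos θ ^ 2 < 1 := by nlinarith [sin_sq_add_cos_sq θ]
    rw [sub_zero, mul_one]
    exact hasDerivAt_arccos (by nlinarith) (by nlinarith)
  refine ((outer.comp (0 : ℝ) inner).pow 2).congr_deriv ?_
  rw [← sin_sq, sqrt_sq hsin.le]
  simp only [Function.comp, sub_zero, mul_one, arccos_cos hθ.1.le hθ.2.le]
  field_simp
  ring

theorem one_sub_cos_eq_sinc (x : ℝ) : 1 - cos x = x ^ 2 * (sinc (x / 2) ^ 2 / 2) := by
  rcases eq_or_ne x 0 with rfl | hx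
  · simp
  · have half_angle := cos_two_mul' (x / 2)
    rw [mul_div_cancel₀ x two_ne_zero, cos_sq'] at half_angle
    rw [sinc_of_ne_zero (div_ne_zero hx two_ne_zero), half_angle]
    field_simp
    ring

theorem bergerEnergy_eq_sinc (κ ν θ : ℝ) :
    bergerEnergy κ ν (-(sin κ * cos θ) / sin ν) =
      ν ^ 2 + κ ^ 2 * (1 / 2 - sinc κ * cos θ * ν / sin ν -
        (sinc κ * cos θ * ν / sin ν) ^ 2 / 2) := by
  have hsinc : sin κ = κ * sinc κ := by
    rcases eq_or_ne κ 0 with rfl | hκ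
    · simp
    · rw [sinc_of_ne_zero hκ, mul_div_cancel₀ _ hκ]
  rw [bergerEnergy, hsinc]
  ring

theorem sin_arccos_mul_cos_pos (hθ : 0 < sin θ) (κ : ℝ) : 0 < sin (arccos (cos θ * cos κ)) := by
  rw [sin_arccos, sqrt_pos]
  nlinarith [sin_sq_add_cos_sq θ, sq_nonneg (cos θ * sin κ), sin_sq_add_cos_sq κ]

-- `ν κ = arccos (cos θ cos κ)`; the energy is expanded in powers of `1 - cos κ ~ κ² / 2`.
theorem exists_bergerEnergy_eq_add (hθ : θ ∈ Set.Ioo 0 π) :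
    ∃ ν Q : ℝ → ℝ, ContinuousAt Q 0 ∧ Q 0 = (1 - (θ * cos θ / sin θ) ^ 2) / 2 ∧
      ∀ κ, 0 < sin (ν κ) ∧ cos (ν κ) = cos θ * cos κ ∧
        bergerEnergy κ (ν κ) (-(sin κ * cos θ) / sin (ν κ)) = θ ^ 2 + κ ^ 2 * Q κ := by
  set ν : ℝ → ℝ := fun κ => arccos (cos θ * cos κ) with hν
  set F : ℝ → ℝ := fun x => arccos (cos θ * (1 - x)) ^ 2 with hF
  set r : ℝ → ℝ := fun κ => sinc κ * cos θ * ν κ / sin (ν κ) with hr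
  have harccos : arccos (cos θ) = θ := arccos_cos hθ.1.le hθ.2.le
  have hF' : HasDerivAt F (2 * (θ * cos θ / sin θ)) 0 := hasDerivAt_arccos_mul_one_sub_sq hθ
  have hνsin (κ : ℝ) : 0 < sin (ν κ) := sin_arccos_mul_cos_pos (sin_pos_of_mem_Ioo hθ) κ
  have hνcos (κ : ℝ) : cos (ν κ) = cos θ * cos κ := by
    have hlt := hνsin κ
    rw [hν, sin_arccos, sqrt_pos] at hlt
    exact cos_arccos (by nlinarith) (by nlinarith)
  refine ⟨ν, fun κ => sinc (κ / 2) ^ 2 / 2 * dslope F 0 (1 - cos κ) + (1 / 2 - r κ - r κ ^ 2 / 2),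
    ?_, ?_, fun κ => ⟨hνsin κ, hνcos κ, ?_⟩⟩
  · have hslope : ContinuousAt (fun κ => dslope F 0 (1 - cos κ)) 0 := by
      refine ContinuousAt.comp (f := fun κ => 1 - cos κ) ?_ (by fun_prop)
      rw [cos_zero, sub_self]
      exact continuousAt_dslope_same.2 hF'.differentiableAt
    have hνc : Continuous ν := continuous_arccos.comp (by fun_prop)
    have hrc : Continuous r :=
      ((continuous_sinc.mul_const _).mul hνc).div (by fun_prop) fun κ => (hνsin κ).ne'
    fun_prop
  · have hr0 : r 0 = θ * cos θ / sin θ := by simp [hr, hν, harccos, mul_comm θ]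
    simp only [zero_div, sinc_zero, cos_zero, sub_self, dslope_same, hF'.deriv, hr0]
    ring
  · have hslope := sub_smul_dslope F 0 (1 - cos κ)
    have hF0 : F 0 = θ ^ 2 := by simp [hF, harccos]
    have hFκ : F (1 - cos κ) = ν κ ^ 2 := by simp [hF, hν]
    rw [hF0, hFκ, sub_zero, smul_eq_mul] at hslope
    rw [bergerEnergy_eq_sinc]
    linear_combination -hslope + dslope F 0 (1 - cos κ) * one_sub_cos_eq_sinc κ

theorem exists_bergerEnergy_lt (hθ : θ ∈ Set.Ioo 0 π) (h : sinAddMulCos θ < 0) :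
    ∃ κ ν, 0 < sin ν ∧ cos ν = cos θ * cos κ ∧
      bergerEnergy κ ν (-(sin κ * cos θ) / sin ν) < θ ^ 2 := by
  obtain ⟨ν, Q, hQc, hQ0, hν⟩ := exists_bergerEnergy_eq_add hθ
  have hcot : θ * cos θ / sin θ < -1 := by
    rw [div_lt_iff₀ (sin_pos_of_mem_Ioo hθ)]
    rw [sinAddMulCos] at h
    linarith
  obtain ⟨κ, hκ, hκ_pos⟩ := ((hQc.eventually_lt_const (by nlinarith : Q 0 < 0)).filter_mono
    nhdsWithin_le_nhds |>.and self_mem_nhdsWithin :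
      ∀ᶠ κ in nhdsWithin 0 (Set.Ioi 0), Q κ < 0 ∧ κ ∈ Set.Ioi 0).exists
  refine ⟨κ, ν κ, (hν κ).1, (hν κ).2.1, ?_⟩
  rw [(hν κ).2.2]
  linarith [mul_neg_of_pos_of_neg (pow_pos hκ_pos 2) hκ]

end BergerOrbit

section CanonicalBound

theorem bergerFrame_add_smul (u v : ℝ) (x y : Fin 4 → ℝ) :
    u • bergerFrame x + v • bergerFrame y = bergerFrame (u • x + v • y) := by
  ext i j
  fin_cases i <;> fin_cases j <;> simp [bergerFrame] <;> ring

theorem riemannianDist_bergerFrame_lt {θ : ℝ} (hθ : θ ∈ Set.Ioo 0 Real.pi)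
    (h : sinAddMulCos θ < 0) :
    riemannianDist (1 / 2) (bergerFrame ![1, 0, 0, 0])
      (bergerFrame ![Real.cos θ, 0, Real.sin θ, 0]) < ENNReal.ofReal (√2 * θ) := by
  obtain ⟨κ, ν, hsin, hcos, henergy⟩ := exists_bergerEnergy_lt hθ h
  obtain ⟨c, hac, hone⟩ := exists_bergerOrbit_one_eq hsin hcos
  rw [← hone, ← bergerOrbit_zero (κ := κ) (ν := ν)]
  refine (riemannianDist_le_of_speed_eq (contDiff_bergerFrame.comp contDiff_bergerOrbit)
    (fun t => bergerFrame_mem (bergerOrbit_dotProduct_self hac t)) (speed_bergerOrbit hac)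
    0 1).trans_lt ?_
  have hθ0 : 0 < θ := hθ.1
  rw [ENNReal.ofReal_lt_ofReal_iff (by positivity), sub_zero, abs_one, one_mul,
    Real.sqrt_mul zero_le_two]
  gcongr
  exact (Real.sqrt_lt' hθ0).2 henergy

theorem injRadius_canonical_le {n p : ℕ} (hp : 2 ≤ p) (hn : p + 2 ≤ n) {τ : ℝ}
    (hτ : τ ∈ Set.Icc (Real.pi / 2) Real.pi) (hzero : sinAddMulCos τ = 0) :
    injRadius (1 / 2) n p ≤ ENNReal.ofReal (τ * √2) := by
  refine (injRadius_antitone (1 / 2) hp (by omega : 4 + p ≤ n + 2)).trans ?_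
  set X := bergerFrame ![1, 0, 0, 0] with hX
  set N := bergerFrame ![0, 0, 1, 0] with hN
  have hXX : Xᵀ * X = 1 := bergerFrame_mem (by simp [dotProduct, Fin.sum_univ_four])
  have hNN : Nᵀ * N = 1 := bergerFrame_mem (by simp [dotProduct, Fin.sum_univ_four])
  have hXN : Xᵀ * N = 0 := by
    rw [bergerFrame_transpose_mul]
    ext i j
    fin_cases i <;> fin_cases j <;> simp [kahlerForm, dotProduct, Fin.sum_univ_four]
  have hsqrt : 0 < √2 := by positivity
  have hunit (t : ℝ) : metric (1 / 2) (greatCircle X N (√2)⁻¹ t)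
      (deriv (greatCircle X N (√2)⁻¹) t) (deriv (greatCircle X N (√2)⁻¹) t) = 1 := by
    rw [metric_deriv_greatCircle hXX hNN hXN, inv_pow, Real.sq_sqrt zero_le_two]
    norm_num
  have horbit (θ : ℝ) :
      greatCircle X N (√2)⁻¹ (√2 * θ) = bergerFrame ![Real.cos θ, 0, Real.sin θ, 0] := by
    rw [greatCircle, inv_mul_cancel_left₀ hsqrt.ne', hX, hN, bergerFrame_add_smul]
    simp
  refine ((isGeodesic_greatCircle hXX hNN hXN (1 / 2) (√2)⁻¹).injRadius_le (hunit 0)).trans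
    (cutTime_le_of_forall_gt (contDiff_greatCircle X N _) (greatCircle_mem hXX hNN hXN _)
      (speed_eq_one_of_metric_eq_one hunit) fun b hb => ?_)
  have hτ_lt : τ < Real.pi := hτ.2.lt_of_ne fun h => by
    simp [h, sinAddMulCos, Real.pi_ne_zero] at hzero
  obtain ⟨θ, hτθ, hθ⟩ := exists_between (lt_min ((lt_div_iff₀ hsqrt).2 hb) hτ_lt)
  rw [lt_min_iff, lt_div_iff₀ hsqrt] at hθ
  have hθ_pos : 0 < θ := by linarith [hτ.1, Real.pi_pos]
  refine ⟨√2 * θ, by linarith, ?_⟩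
  have hstart := horbit 0
  rw [mul_zero, Real.cos_zero, Real.sin_zero] at hstart
  rw [hstart, horbit]
  exact riemannianDist_bergerFrame_lt ⟨hθ_pos, hθ.2⟩
    (sinAddMulCos_neg_of_gt hτ hzero hτθ hθ.2.le)

end CanonicalBound

section Momentum

variable {n p : ℕ} {β : ℝ} {X ξ : Matrix (Fin n) (Fin p) ℝ} {B : Matrix (Fin n) (Fin n) ℝ}

theorem mul_mem_tangentSpace_of_skew (hB : Bᵀ = -B) : B * X ∈ tangentSpace X := by
  change Xᵀ * (B * X) + (B * X)ᵀ * X = 0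
  rw [Matrix.transpose_mul, hB, Matrix.mul_neg, Matrix.neg_mul, Matrix.mul_assoc, add_neg_cancel]

/-- The momentum map of the action of the orthogonal group on the Stiefel manifold with the
canonical metric, where the dual of the Lie algebra is identified with the skew-symmetric matrices
by the trace form. -/
def momentum (X ξ : Matrix (Fin n) (Fin p) ℝ) : Matrix (Fin n) (Fin n) ℝ :=
  ξ * Xᵀ - X * ξᵀ + X * (ξᵀ * X * Xᵀ)

theorem momentum_skew (hξ : ξ ∈ tangentSpace X) : (momentum X ξ)ᵀ = -momentum X ξ := by
  have h : Xᵀ * ξ = -(ξᵀ * X) := eq_neg_of_add_eq_zero_left hξ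
  simp only [momentum, Matrix.transpose_add, Matrix.transpose_sub, Matrix.transpose_mul,
    Matrix.transpose_transpose, h, Matrix.neg_mul, Matrix.mul_neg, Matrix.mul_assoc]
  abel

theorem momentum_mul (hX : X ∈ manifold n p) : momentum X ξ * X = ξ := by
  have hX : Xᵀ * X = 1 := hX
  simp only [momentum, Matrix.add_mul, Matrix.sub_mul, Matrix.mul_assoc, hX, Matrix.mul_one]
  abel

theorem trace_transpose_mul_momentum (hB : Bᵀ = -B) :
    (Bᵀ * momentum X ξ).trace = 2 * metric (1 / 2) X ξ (B * X) := by
  have first : (Bᵀ * (ξ * Xᵀ)).trace = (ξᵀ * (B * X)).trace := by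
    rw [← Matrix.trace_transpose, ← Matrix.mul_assoc ξᵀ, Matrix.trace_mul_comm _ X]
    simp [Matrix.mul_assoc]
  have second : (B * (X * ξᵀ)).trace = (ξᵀ * (B * X)).trace := by
    rw [← Matrix.mul_assoc, Matrix.trace_mul_comm]
  have third : (B * (X * (ξᵀ * X * Xᵀ))).trace = ((Xᵀ * ξ)ᵀ * (Xᵀ * (B * X))).trace := by
    rw [← Matrix.mul_assoc, Matrix.trace_mul_comm, Matrix.transpose_mul, Matrix.transpose_transpose,
      Matrix.mul_assoc]
  rw [momentum, Matrix.mul_add, Matrix.mul_sub, Matrix.trace_add, Matrix.trace_sub, first, hB,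
    Matrix.neg_mul, Matrix.neg_mul, Matrix.trace_neg, Matrix.trace_neg, second, third, metric_eq]
  ring

theorem trace_momentum_transpose_mul_self (hX : X ∈ manifold n p) (hξ : ξ ∈ tangentSpace X) :
    ((momentum X ξ)ᵀ * momentum X ξ).trace = 2 * metric (1 / 2) X ξ ξ := by
  rw [trace_transpose_mul_momentum (momentum_skew hξ), momentum_mul hX]

/-- Infinitesimal invariance of the metric under the rotations generated by `B`. -/
theorem metric_mul_add_metricDeriv_mul (hB : Bᵀ = -B) :
    metric β X ξ (B * ξ) + metricDeriv β X (B * X) ξ ξ / 2 = 0 := by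
  have quadratic_zero : (ξᵀ * (B * ξ)).trace = 0 := by
    rw [← Matrix.mul_assoc, Matrix.trace_mul_comm, ← Matrix.mul_assoc]
    exact trace_mul_eq_zero_of_symm_of_skew (by simp) hB
  have swap : ((Xᵀ * (B * ξ))ᵀ * (Xᵀ * ξ)).trace = ((Xᵀ * ξ)ᵀ * (Xᵀ * (B * ξ))).trace := by
    rw [← Matrix.trace_transpose, Matrix.transpose_mul, Matrix.transpose_transpose]
  rw [metric_eq, metricDeriv_eq, quadratic_zero, Matrix.transpose_mul B, hB, Matrix.mul_neg,
    Matrix.neg_mul, Matrix.mul_assoc Xᵀ, Matrix.transpose_neg, Matrix.neg_mul, Matrix.mul_neg,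
    Matrix.trace_add, Matrix.trace_neg, Matrix.trace_neg, swap]
  ring

namespace IsGeodesic

variable {γ : ℝ → Matrix (Fin n) (Fin p) ℝ}

-- Noether's theorem for the Killing field `X ↦ B X`.
theorem metric_deriv_mul_eq (hγ : IsGeodesic β γ) (hB : Bᵀ = -B) (s t : ℝ) :
    metric β (γ s) (deriv γ s) (B * γ s) = metric β (γ t) (deriv γ t) (B * γ t) := by
  have hderiv (r : ℝ) : HasDerivAt (fun r => metric β (γ r) (deriv γ r) (B * γ r)) 0 r := by
    have killing : HasDerivAt (fun r => B * γ r) (B * deriv γ r) r :=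
      (hasDerivAt_matrix_mul (hasDerivAt_const r B) (hγ.hasDerivAt r)).congr_deriv (by simp)
    have acceleration_zero := hγ.2.2 r _ (mul_mem_tangentSpace_of_skew hB)
    refine (hasDerivAt_metric β (hγ.hasDerivAt r) (hγ.hasDerivAt_deriv r) killing).congr_deriv ?_
    rw [covariantAcceleration, metricDeriv_eq β _ (deriv γ r)] at acceleration_zero
    linear_combination acceleration_zero +
      metric_mul_add_metricDeriv_mul (β := β) (X := γ r) (ξ := deriv γ r) hB
  exact is_const_of_deriv_eq_zero (fun r => (hderiv r).differentiableAt)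
    (fun r => (hderiv r).deriv) s t

theorem momentum_eq (hγ : IsGeodesic (1 / 2) γ) (s t : ℝ) :
    momentum (γ s) (deriv γ s) = momentum (γ t) (deriv γ t) := by
  set B := momentum (γ s) (deriv γ s) - momentum (γ t) (deriv γ t) with hB
  have hskew : Bᵀ = -B := by
    rw [hB, Matrix.transpose_sub, momentum_skew (hγ.deriv_mem s), momentum_skew (hγ.deriv_mem t)]
    abel
  have hnorm : (Bᵀ * B).trace = 0 := by
    conv_lhs => rw [hB, Matrix.mul_sub, Matrix.trace_sub]
    rw [trace_transpose_mul_momentum hskew, trace_transpose_mul_momentum hskew,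
      hγ.metric_deriv_mul_eq hskew s t, sub_self]
  rw [← Matrix.conjTranspose_eq_transpose_of_trivial,
    Matrix.trace_conjTranspose_mul_self_eq_zero_iff] at hnorm
  exact sub_eq_zero.1 hnorm

theorem hasDerivAt_momentum_mul (hγ : IsGeodesic (1 / 2) γ) (t : ℝ) :
    HasDerivAt γ (momentum (γ 0) (deriv γ 0) * γ t) t := by
  rw [hγ.momentum_eq 0 t, momentum_mul (hγ.2.1 t)]
  exact hγ.hasDerivAt t

end IsGeodesic

end Momentum

section Calibration

variable {ι : Type*} [Fintype ι]

theorem dotProduct_sq_le (u v : ι → ℝ) : (u ⬝ᵥ v) ^ 2 ≤ (u ⬝ᵥ u) * (v ⬝ᵥ v) := by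
  simpa only [dotProduct, sq] using Finset.sum_mul_sq_le_sq_mul_sq Finset.univ u v

theorem dotProduct_sq_le_of_dotProduct_eq_zero {u x y : ι → ℝ} (hu : u ⬝ᵥ u = 1)
    (hx : x ⬝ᵥ x = 1) (hxy : x ⬝ᵥ y = 0) :
    (u ⬝ᵥ y) ^ 2 ≤ (1 - (u ⬝ᵥ x) ^ 2) * (y ⬝ᵥ y) := by
  have h := dotProduct_sq_le (u - (u ⬝ᵥ x) • x) y
  simp only [sub_dotProduct, dotProduct_sub, smul_dotProduct, dotProduct_smul, hu, hx, hxy,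
    dotProduct_comm x u, smul_eq_mul] at h
  linear_combination h

theorem hasDerivAt_dotProduct {x y : ℝ → ι → ℝ} {x' y' : ι → ℝ} {t : ℝ} (hx : HasDerivAt x x' t)
    (hy : HasDerivAt y y' t) :
    HasDerivAt (fun s => x s ⬝ᵥ y s) (x' ⬝ᵥ y t + x t ⬝ᵥ y') t := by
  rw [hasDerivAt_pi] at hx hy
  simp only [dotProduct, ← Finset.sum_add_distrib]
  exact HasDerivAt.fun_sum fun i _ => (hx i).mul (hy i)

theorem dotProduct_eq_zero_of_hasDerivAt {x : ℝ → ι → ℝ} {y : ι → ℝ} {t : ℝ}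
    (hx : HasDerivAt x y t) (hunit : ∀ᶠ s in nhds t, x s ⬝ᵥ x s = 1) : x t ⬝ᵥ y = 0 := by
  have h := (hasDerivAt_dotProduct hx hx).unique
    ((hasDerivAt_const t (1 : ℝ)).congr_of_eventuallyEq hunit)
  rw [dotProduct_comm y] at h
  linarith

/-- The factor `r < 1` keeps the spherical distance `arccos (u ⬝ᵥ x)` differentiable at `x = ± u`,
and does not make it more expanding. -/
theorem exists_hasDerivAt_arccos_mul_dotProduct {u : ι → ℝ} {x : ℝ → ι → ℝ} {y : ι → ℝ} {r t : ℝ}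
    (hu : u ⬝ᵥ u = 1) (hx : HasDerivAt x y t) (hunit : ∀ᶠ s in nhds t, x s ⬝ᵥ x s = 1)
    (hr : r ∈ Set.Ico 0 1) :
    ∃ k, HasDerivAt (fun s => Real.arccos (r * (u ⬝ᵥ x s))) k t ∧ k ≤ √(y ⬝ᵥ y) := by
  obtain ⟨hr0, hr1⟩ := hr
  set q := u ⬝ᵥ x t
  have hq : q ^ 2 ≤ 1 := by simpa [hu, hunit.self_of_nhds] using dotProduct_sq_le u (x t)
  have hy : (u ⬝ᵥ y) ^ 2 ≤ (1 - q ^ 2) * (y ⬝ᵥ y) :=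
    dotProduct_sq_le_of_dotProduct_eq_zero hu hunit.self_of_nhds
      (dotProduct_eq_zero_of_hasDerivAt hx hunit)
  have hy0 : 0 ≤ y ⬝ᵥ y := Finset.sum_nonneg fun i _ => mul_self_nonneg (y i)
  have hr2 : r ^ 2 < 1 := by nlinarith
  have hrq : (r * q) ^ 2 < 1 := by nlinarith [mul_pow r q 2, sq_nonneg r]
  have hqd : HasDerivAt (fun s => u ⬝ᵥ x s) (u ⬝ᵥ y) t := by
    simpa using hasDerivAt_dotProduct (hasDerivAt_const t u) hx
  have harccos := (Real.hasDerivAt_arccos (x := r * q) (by nlinarith) (by nlinarith)).comp t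
    (hqd.const_mul r)
  refine ⟨_, harccos, Real.le_sqrt_of_sq_le ?_⟩
  have hpos : 0 < 1 - (r * q) ^ 2 := by linarith
  rw [mul_pow, neg_sq, div_pow, Real.sq_sqrt hpos.le, one_pow, one_div, inv_mul_le_iff₀ hpos]
  calc (r * (u ⬝ᵥ y)) ^ 2 = r ^ 2 * (u ⬝ᵥ y) ^ 2 := mul_pow ..
    _ ≤ r ^ 2 * ((1 - q ^ 2) * (y ⬝ᵥ y)) := by gcongr
    _ ≤ (1 - (r * q) ^ 2) * (y ⬝ᵥ y) := by nlinarith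

theorem sum_mul_arccos_sub_le_curveLength {κ : Type*} [Fintype κ] {n p : ℕ} {β : ℝ}
    {c : ℝ → Matrix (Fin n) (Fin p) ℝ} (hc : IsPiecewiseC1Curve c) {a : ι → ℝ} (ha : ∀ j, 0 ≤ a j)
    {u : ι → κ → ℝ} (hu : ∀ j, u j ⬝ᵥ u j = 1) {x : ι → ℝ → κ → ℝ}
    (hx : ∀ j, ContinuousOn (x j) (Set.Icc 0 1))
    (hunit : ∀ j, ∀ s ∈ Set.Icc (0 : ℝ) 1, x j s ⬝ᵥ x j s = 1)
    (hderiv : ∀ t ∈ Set.Ioo (0 : ℝ) 1, ∀ ξ, HasDerivAt c ξ t → ∃ y : ι → κ → ℝ,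
      (∀ j, HasDerivAt (x j) (y j) t) ∧ ∑ j, a j * √(y j ⬝ᵥ y j) ≤ √(metric β (c t) ξ ξ)) :
    ∑ j, a j * Real.arccos (u j ⬝ᵥ x j 1) - ∑ j, a j * Real.arccos (u j ⬝ᵥ x j 0) ≤
      curveLength β c := by
  set g : ℝ → ℝ → ℝ := fun r s => ∑ j, a j * Real.arccos (r * (u j ⬝ᵥ x j s)) with hg
  have hcont (r : ℝ) : ContinuousOn (g r) (Set.Icc 0 1) :=
    continuousOn_finsetSum _ fun j _ => continuousOn_const.mul
      (Real.continuous_arccos.comp_continuousOn (continuousOn_const.mul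
        ((continuous_const.dotProduct continuous_id).comp_continuousOn (hx j))))
  have hle (r : ℝ) (hr : r ∈ Set.Ico 0 1) : g r 1 - g r 0 ≤ curveLength β c := by
    refine hc.sub_le_curveLength (hcont r) fun t ht ξ hξ => ?_
    obtain ⟨y, hy, hsum⟩ := hderiv t ht ξ hξ
    choose k hk hky using fun j => exists_hasDerivAt_arccos_mul_dotProduct (hu j) (hy j)
      (Filter.eventually_of_mem (Icc_mem_nhds ht.1 ht.2) (hunit j)) hr
    exact ⟨∑ j, a j * k j, HasDerivAt.fun_sum fun j _ => (hk j).const_mul (a j),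
      (Finset.sum_le_sum fun j _ => mul_le_mul_of_nonneg_left (hky j) (ha j)).trans hsum⟩
  have hlim : Filter.Tendsto (fun r => g r 1 - g r 0) (nhdsWithin 1 (Set.Iio 1))
      (nhds (g 1 1 - g 1 0)) :=
    ((by fun_prop : Continuous fun r => g r 1 - g r 0).tendsto 1).mono_left nhdsWithin_le_nhds
  have hlim_le : g 1 1 - g 1 0 ≤ curveLength β c := by
    refine le_of_tendsto hlim ?_
    filter_upwards [Ico_mem_nhdsLT (zero_lt_one : (0 : ℝ) < 1)] with r hr using hle r hr
  simpa only [hg, one_mul] using hlim_le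

end Calibration

section SkewFlow

theorem eq_cos_of_hasDerivAt {μ : ℝ} {y z : ℝ → ℝ} (hy : ∀ t, HasDerivAt y (z t) t)
    (hz : ∀ t, HasDerivAt z (-(μ ^ 2 * y t)) t) (hy0 : y 0 = 1) (hz0 : z 0 = 0) (t : ℝ) :
    y t = Real.cos (μ * t) := by
  have hμ (t : ℝ) : HasDerivAt (fun t => μ * t) μ t := by simpa using (hasDerivAt_id t).const_mul μ
  set e : ℝ → ℝ := fun t => y t - Real.cos (μ * t) with he
  set f : ℝ → ℝ := fun t => z t + μ * Real.sin (μ * t) with hf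
  have hed (t : ℝ) : HasDerivAt e (f t) t := ((hy t).sub (hμ t).cos).congr_deriv (by ring)
  have hfd (t : ℝ) : HasDerivAt f (-(μ ^ 2 * e t)) t :=
    ((hz t).add ((hμ t).sin.const_mul μ)).congr_deriv (by ring)
  have energy_deriv (t : ℝ) : HasDerivAt (fun t => f t ^ 2 + μ ^ 2 * e t ^ 2) 0 t :=
    (((hfd t).pow 2).add (((hed t).pow 2).const_mul (μ ^ 2))).congr_deriv (by push_cast; ring)
  have energy_zero (t : ℝ) : f t ^ 2 + μ ^ 2 * e t ^ 2 = 0 := by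
    rw [is_const_of_deriv_eq_zero (fun s => (energy_deriv s).differentiableAt)
      (fun s => (energy_deriv s).deriv) t 0]
    simp [he, hf, hy0, hz0]
  have hf0 (t : ℝ) : f t = 0 :=
    pow_eq_zero_iff two_ne_zero |>.1 (by nlinarith [energy_zero t, sq_nonneg (μ * e t)])
  have he0 : e t = e 0 := is_const_of_deriv_eq_zero (fun s => (hed s).differentiableAt)
    (fun s => (hed s).deriv.trans (hf0 s)) t 0
  simp only [he, hy0, mul_zero, Real.cos_zero, sub_self] at he0
  linarith

variable {ι : Type*} [Fintype ι] {A : Matrix ι ι ℝ}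

theorem dotProduct_mulVec_skew (hA : Aᵀ = -A) (u v : ι → ℝ) :
    u ⬝ᵥ (A *ᵥ v) = -((A *ᵥ u) ⬝ᵥ v) := by
  rw [Matrix.dotProduct_mulVec, ← Matrix.mulVec_transpose, hA, Matrix.neg_mulVec, neg_dotProduct]

theorem dotProduct_mulVec_skew_self (hA : Aᵀ = -A) (u : ι → ℝ) : u ⬝ᵥ (A *ᵥ u) = 0 := by
  have h := dotProduct_mulVec_skew hA u u
  rw [dotProduct_comm (A *ᵥ u)] at h
  linarith

theorem dotProduct_eq_cos_of_hasDerivAt_mulVec (hA : Aᵀ = -A) {x : ℝ → ι → ℝ}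
    (hx : ∀ t, HasDerivAt x (A *ᵥ x t) t) (h0 : x 0 ⬝ᵥ x 0 = 1) {μ : ℝ}
    (hμ : A *ᵥ (A *ᵥ x 0) = -(μ ^ 2 • x 0)) (t : ℝ) : x 0 ⬝ᵥ x t = Real.cos (μ * t) := by
  have hconst (v : ι → ℝ) (t : ℝ) : HasDerivAt (fun s => v ⬝ᵥ x s) (-((A *ᵥ v) ⬝ᵥ x t)) t := by
    simpa [dotProduct_mulVec_skew hA] using hasDerivAt_dotProduct (hasDerivAt_const t v) (hx t)
  have hsecond (t : ℝ) :
      HasDerivAt (fun s => -((A *ᵥ x 0) ⬝ᵥ x s)) (-(μ ^ 2 * (x 0 ⬝ᵥ x t))) t :=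
    (hconst (A *ᵥ x 0) t).neg.congr_deriv (by simp [hμ])
  refine eq_cos_of_hasDerivAt (hconst (x 0)) hsecond h0 ?_ t
  rw [dotProduct_comm, dotProduct_mulVec_skew_self hA, neg_zero]

end SkewFlow

section MulVec

variable {ι κ : Type*} [Fintype κ]

theorem hasDerivAt_mulVec {A : ℝ → Matrix ι κ ℝ} {A' : Matrix ι κ ℝ} {t : ℝ}
    (hA : HasDerivAt A A' t) (v : κ → ℝ) : HasDerivAt (fun s => A s *ᵥ v) (A' *ᵥ v) t :=
  hasDerivAt_pi.2 fun i => HasDerivAt.fun_sum fun j _ =>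
    (hasDerivAt_matrix.1 hA i j).mul_const (v j)

variable [Fintype ι]

theorem mulVec_dotProduct_mulVec (A B : Matrix ι κ ℝ) (u v : κ → ℝ) :
    (A *ᵥ u) ⬝ᵥ (B *ᵥ v) = u ⬝ᵥ ((Aᵀ * B) *ᵥ v) := by
  rw [← Matrix.mulVec_mulVec, Matrix.dotProduct_mulVec u, Matrix.vecMul_transpose]

theorem mulVec_dotProduct_self [DecidableEq κ] {A : Matrix ι κ ℝ} (hA : Aᵀ * A = 1) (u : κ → ℝ) :
    (A *ᵥ u) ⬝ᵥ (A *ᵥ u) = u ⬝ᵥ u := by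
  rw [mulVec_dotProduct_mulVec, hA, Matrix.one_mulVec]

end MulVec

section Sphere

variable {n : ℕ} {β : ℝ} {X ξ η : Matrix (Fin n) (Fin 1) ℝ} {γ : ℝ → Matrix (Fin n) (Fin 1) ℝ}

theorem transpose_mul_eq_zero (hξ : ξ ∈ tangentSpace X) : Xᵀ * ξ = 0 := by
  have hskew := transpose_mul_skew hξ
  ext i j
  obtain rfl := Subsingleton.elim i j
  have hdiag := congrFun (congrFun hskew i) i
  rw [Matrix.transpose_apply, Matrix.neg_apply] at hdiag
  rw [Matrix.zero_apply]
  linarith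

theorem metric_sphere (hξ : ξ ∈ tangentSpace X) : metric β X ξ ξ = (ξ *ᵥ 1) ⬝ᵥ (ξ *ᵥ 1) := by
  rw [metric_eq, transpose_mul_eq_zero hξ, mulVec_dotProduct_mulVec]
  simp [Matrix.trace, Matrix.mulVec, dotProduct]

theorem IsGeodesic.sphere {β' : ℝ} (hγ : IsGeodesic β γ) : IsGeodesic β' γ := by
  refine ⟨hγ.1, hγ.2.1, fun t η hη => ?_⟩
  have hderiv := transpose_mul_eq_zero (hγ.deriv_mem t)
  have hderiv' : (deriv γ t)ᵀ * γ t = 0 := by simpa using congrArg Matrix.transpose hderiv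
  have acceleration_zero := hγ.2.2 t η hη
  rw [covariantAcceleration_eq, transpose_mul_eq_zero hη, hderiv, hderiv'] at acceleration_zero ⊢
  simpa using acceleration_zero

theorem momentum_mul_of_transpose_mul_eq_zero {n p : ℕ} {X ξ : Matrix (Fin n) (Fin p) ℝ}
    (h : Xᵀ * ξ = 0) : momentum X ξ * ξ = -(X * (ξᵀ * ξ)) := by
  simp [momentum, Matrix.add_mul, Matrix.sub_mul, Matrix.mul_assoc, h]

theorem IsGeodesic.dotProduct_eq_cos (hγ : IsGeodesic β γ)
    (hunit : metric β (γ 0) (deriv γ 0) (deriv γ 0) = 1) (t : ℝ) :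
    (γ 0 *ᵥ 1) ⬝ᵥ (γ t *ᵥ 1) = Real.cos t := by
  have hξ := hγ.deriv_mem 0
  set B := momentum (γ 0) (deriv γ 0) with hB
  have gram : (deriv γ 0)ᵀ * deriv γ 0 = 1 := by
    ext i j
    rw [metric_sphere hξ, mulVec_dotProduct_mulVec] at hunit
    rw [Subsingleton.elim i 0, Subsingleton.elim j 0]
    simpa [Matrix.mulVec, dotProduct] using hunit
  have hBB : B *ᵥ (B *ᵥ (γ 0 *ᵥ 1)) = -((1 : ℝ) ^ 2 • (γ 0 *ᵥ 1)) := by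
    rw [Matrix.mulVec_mulVec, Matrix.mulVec_mulVec, hB, Matrix.mul_assoc, momentum_mul (hγ.2.1 0),
      momentum_mul_of_transpose_mul_eq_zero (transpose_mul_eq_zero hξ), gram, Matrix.mul_one,
      Matrix.neg_mulVec, one_pow, one_smul]
  have hflow (t : ℝ) : HasDerivAt (fun s => γ s *ᵥ 1) (B *ᵥ (γ t *ᵥ 1)) t := by
    simpa [Matrix.mulVec_mulVec] using
      hasDerivAt_mulVec (hγ.sphere.hasDerivAt_momentum_mul t) (1 : Fin 1 → ℝ)
  have hx0 : (γ 0 *ᵥ (1 : Fin 1 → ℝ)) ⬝ᵥ (γ 0 *ᵥ 1) = 1 :=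
    (mulVec_dotProduct_self (hγ.2.1 0) 1).trans (by simp [dotProduct])
  simpa using dotProduct_eq_cos_of_hasDerivAt_mulVec (momentum_skew hξ) hflow hx0 hBB t

theorem arccos_sub_le_curveLength_sphere {c : ℝ → Matrix (Fin n) (Fin 1) ℝ}
    (hc : IsPiecewiseC1Curve c) {u : Fin n → ℝ} (hu : u ⬝ᵥ u = 1) :
    Real.arccos (u ⬝ᵥ (c 1 *ᵥ 1)) - Real.arccos (u ⬝ᵥ (c 0 *ᵥ 1)) ≤ curveLength β c := by
  have hcont : ContinuousOn (fun s => c s *ᵥ (1 : Fin 1 → ℝ)) (Set.Icc 0 1) :=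
    (continuous_id.matrix_mulVec continuous_const).comp_continuousOn hc.1
  have hunit (s : ℝ) (hs : s ∈ Set.Icc (0 : ℝ) 1) :
      (c s *ᵥ (1 : Fin 1 → ℝ)) ⬝ᵥ (c s *ᵥ 1) = 1 :=
    (mulVec_dotProduct_self (hc.2.1 s hs) 1).trans (by simp [dotProduct])
  have h := sum_mul_arccos_sub_le_curveLength (β := β) (ι := Unit) hc (fun _ => zero_le_one)
    (fun _ => hu) (fun _ => hcont) (fun _ => hunit) fun t ht ξ hξ =>
      ⟨fun _ => ξ *ᵥ 1, fun _ => hasDerivAt_mulVec hξ 1, by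
        have hmem := deriv_mem_tangentSpace
          (Filter.eventually_of_mem (Icc_mem_nhds ht.1 ht.2) hc.2.1) hξ
        simp [metric_sphere hmem]⟩
  simpa using h

theorem pi_le_injRadius_sphere (n : ℕ) (β : ℝ) : ENNReal.ofReal Real.pi ≤ injRadius β n 1 := by
  refine le_injRadius fun γ hγ hunit => le_cutTime hγ.contDiff_one hγ.2.1
    (speed_eq_one_of_metric_eq_one hunit) Real.pi_pos fun c hc hc0 hc1 => ?_
  have hcos := hγ.dotProduct_eq_cos (hunit 0)
  have h := arccos_sub_le_curveLength_sphere (β := β) hc ((hcos 0).trans Real.cos_zero)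
  simpa [hc0, hc1, hcos] using h

end Sphere

section Normal

variable {p : ℕ} {Z : Matrix (Fin (p + 1)) (Fin p) ℝ}

/-- The unit normal of the hyperplane spanned by the frame `Z`: the generalized cross product of
its columns, which is the last row of the adjugate of `[Z 0]`. -/
def normal (Z : Matrix (Fin (p + 1)) (Fin p) ℝ) : Matrix (Fin (p + 1)) (Fin 1) ℝ :=
  (Matrix.adjugate (Z * (inclusion (Fin.castSucc : Fin p → Fin (p + 1)))ᵀ))ᵀ *
    inclusion fun _ : Fin 1 => Fin.last p

theorem contDiff_normal {k : WithTop ℕ∞} : ContDiff ℝ k (normal (p := p)) := by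
  rw [contDiff_matrix]
  intro i j
  simp only [normal, Matrix.mul_apply (M := (Matrix.adjugate _)ᵀ), Matrix.transpose_apply,
    Matrix.adjugate_apply, Matrix.det_apply]
  refine ContDiff.sum fun l _ => ContDiff.mul (ContDiff.sum fun σ _ => ContDiff.const_smul _
    (contDiff_prod fun a _ => ?_)) contDiff_const
  by_cases h : σ a = i
  · simp only [h, Matrix.updateRow_self]
    exact contDiff_const
  · simp only [Matrix.updateRow_ne h]
    exact contDiff_matrix.1 (contDiff_matrix_mul contDiff_id contDiff_const) (σ a) a

theorem normal_transpose_mul (Z : Matrix (Fin (p + 1)) (Fin p) ℝ) : (normal Z)ᵀ * Z = 0 := by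
  set E : Matrix (Fin (p + 1)) (Fin p) ℝ := inclusion Fin.castSucc with hE
  have hZ : Z = Z * Eᵀ * E := by
    rw [Matrix.mul_assoc, inclusion_transpose_mul_self (Fin.castSucc_injective p), Matrix.mul_one]
  conv_lhs => arg 2; rw [hZ]
  rw [normal, Matrix.transpose_mul, Matrix.transpose_transpose, Matrix.mul_assoc,
    ← Matrix.mul_assoc (Matrix.adjugate _), ← hE, Matrix.adjugate_mul, Matrix.smul_mul,
    Matrix.one_mul, Matrix.mul_smul,
    inclusion_transpose_mul_eq_zero fun _ j => (Fin.castSucc_ne_last j).symm, smul_zero]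

theorem transpose_mul_normal (Z : Matrix (Fin (p + 1)) (Fin p) ℝ) : Zᵀ * normal Z = 0 := by
  simpa using congrArg Matrix.transpose (normal_transpose_mul Z)

theorem inclusion_castSucc_mul_transpose (p : ℕ) :
    inclusion (Fin.castSucc : Fin p → Fin (p + 1)) *
        (inclusion (Fin.castSucc : Fin p → Fin (p + 1)))ᵀ =
      Matrix.diagonal fun i => if i = Fin.last p then (0 : ℝ) else 1 := by
  ext i j
  induction i using Fin.lastCases <;> induction j using Fin.lastCases <;>
    simp [inclusion, Matrix.mul_apply, Matrix.one_apply, Matrix.diagonal_apply,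
      Fin.castSucc_ne_last, (Fin.castSucc_ne_last _).symm, eq_comm]

theorem normal_mem (hZ : Z ∈ manifold (p + 1) p) : normal Z ∈ manifold (p + 1) 1 := by
  set E : Matrix (Fin (p + 1)) (Fin p) ℝ := inclusion Fin.castSucc with hE
  have hZ : Zᵀ * Z = 1 := hZ
  have gram : (Z * Eᵀ)ᵀ * (Z * Eᵀ) =
      Matrix.diagonal fun i => if i = Fin.last p then (0 : ℝ) else 1 := by
    rw [Matrix.transpose_mul, Matrix.transpose_transpose, Matrix.mul_assoc, ← Matrix.mul_assoc Zᵀ,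
      hZ, Matrix.one_mul, inclusion_castSucc_mul_transpose]
  have adjugate_gram := congrArg Matrix.adjugate gram
  rw [Matrix.adjugate_mul_distrib, ← Matrix.adjugate_transpose,
    Matrix.adjugate_diagonal] at adjugate_gram
  change (normal Z)ᵀ * normal Z = 1
  rw [normal, Matrix.transpose_mul, Matrix.transpose_transpose, Matrix.mul_assoc,
    ← Matrix.mul_assoc (Matrix.adjugate _), ← hE, adjugate_gram]
  ext i j
  simp [Subsingleton.elim i j, inclusion, Matrix.mul_apply, Matrix.diagonal_apply,
    Matrix.one_apply]

theorem mul_transpose_add_normal (hZ : Z ∈ manifold (p + 1) p) :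
    Z * Zᵀ + normal Z * (normal Z)ᵀ = 1 := by
  have hZ' : Zᵀ * Z = 1 := hZ
  have hn : (normal Z)ᵀ * normal Z = 1 := normal_mem hZ
  have gram : (Matrix.fromCols Z (normal Z))ᵀ * Matrix.fromCols Z (normal Z) = 1 := by
    rw [Matrix.transpose_fromCols, Matrix.fromRows_mul_fromCols, hZ', normal_transpose_mul,
      transpose_mul_normal, hn, Matrix.fromBlocks_one]
  have gram' := (Matrix.mul_eq_one_comm_of_card_eq _ _ _ (by simp)).1 gram
  rwa [Matrix.transpose_fromCols, Matrix.fromCols_mul_fromRows] at gram'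

theorem eq_momentum_mul_of_hasDerivAt {n p : ℕ} {c : ℝ → Matrix (Fin n) (Fin p) ℝ}
    {ν : ℝ → Matrix (Fin n) (Fin 1) ℝ} {ξ : Matrix (Fin n) (Fin p) ℝ}
    {w : Matrix (Fin n) (Fin 1) ℝ} {t : ℝ} (hν : ∀ᶠ s in nhds t, ν s ∈ manifold n 1)
    (hcν : ∀ s, (c s)ᵀ * ν s = 0) (hcomplete : c t * (c t)ᵀ + ν t * (ν t)ᵀ = 1)
    (hc : HasDerivAt c ξ t) (hw : HasDerivAt ν w t) : w = momentum (c t) ξ * ν t := by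
  have normal_component : (ν t)ᵀ * w = 0 := transpose_mul_eq_zero (deriv_mem_tangentSpace hν hw)
  have product_rule : ξᵀ * ν t + (c t)ᵀ * w = 0 := by
    refine (hasDerivAt_matrix_mul (hasDerivAt_matrix_transpose hc) hw).unique ?_
    simp only [hcν]
    exact hasDerivAt_const t _
  calc w = (c t * (c t)ᵀ + ν t * (ν t)ᵀ) * w := by rw [hcomplete, Matrix.one_mul]
    _ = -(c t * (ξᵀ * ν t)) := by
      rw [Matrix.add_mul, Matrix.mul_assoc, Matrix.mul_assoc, normal_component,
        eq_neg_of_add_eq_zero_right product_rule, Matrix.mul_zero, add_zero, Matrix.mul_neg]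
    _ = momentum (c t) ξ * ν t := by
      simp only [momentum, Matrix.add_mul, Matrix.sub_mul, Matrix.mul_assoc, hcν,
        Matrix.mul_zero, zero_sub, add_zero]

theorem hasDerivAt_normal {c : ℝ → Matrix (Fin (p + 1)) (Fin p) ℝ}
    {ξ : Matrix (Fin (p + 1)) (Fin p) ℝ} {t : ℝ} (hmem : ∀ᶠ s in nhds t, c s ∈ manifold (p + 1) p)
    (hc : HasDerivAt c ξ t) :
    HasDerivAt (fun s => normal (c s)) (momentum (c t) ξ * normal (c t)) t := by
  have hdiff : DifferentiableAt ℝ normal (c t) :=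
    (contDiff_normal (k := 1)).differentiable one_ne_zero (c t)
  have hw := hdiff.hasFDerivAt.comp_hasDerivAt t hc
  exact hw.congr_deriv (eq_momentum_mul_of_hasDerivAt (hmem.mono fun _ => normal_mem)
    (fun s => transpose_mul_normal (c s)) (mul_transpose_add_normal hmem.self_of_nhds) hc hw)

end Normal

section Rotation

variable {p : ℕ} {X Z : Matrix (Fin (p + 1)) (Fin p) ℝ}

/-- The rotation of `ℝᵖ⁺¹` that maps the frame `X` to the frame `Z`. Fixing `X`, it identifies
`St(p+1,p)` with the rotation group. -/
def rotation (X Z : Matrix (Fin (p + 1)) (Fin p) ℝ) : Matrix (Fin (p + 1)) (Fin (p + 1)) ℝ :=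
  Z * Xᵀ + normal Z * (normal X)ᵀ

theorem continuous_rotation (X : Matrix (Fin (p + 1)) (Fin p) ℝ) : Continuous (rotation X) :=
  (continuous_id.matrix_mul continuous_const).add
    ((contDiff_normal (k := 0)).continuous.matrix_mul continuous_const)

theorem rotation_orthogonal (hX : X ∈ manifold (p + 1) p) (hZ : Z ∈ manifold (p + 1) p) :
    (rotation X Z)ᵀ * rotation X Z = 1 := by
  have hZ' : Zᵀ * Z = 1 := hZ
  have hn : (normal Z)ᵀ * normal Z = 1 := normal_mem hZ
  rw [← mul_transpose_add_normal hX]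
  simp only [rotation, Matrix.transpose_add, Matrix.transpose_mul, Matrix.transpose_transpose,
    Matrix.mul_add, Matrix.add_mul, Matrix.mul_assoc]
  rw [← Matrix.mul_assoc Zᵀ, ← Matrix.mul_assoc Zᵀ, ← Matrix.mul_assoc (normal Z)ᵀ,
    ← Matrix.mul_assoc (normal Z)ᵀ, hZ', normal_transpose_mul, transpose_mul_normal, hn]
  simp

theorem hasDerivAt_rotation (X : Matrix (Fin (p + 1)) (Fin p) ℝ)
    {c : ℝ → Matrix (Fin (p + 1)) (Fin p) ℝ} {ξ : Matrix (Fin (p + 1)) (Fin p) ℝ} {t : ℝ}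
    (hmem : ∀ᶠ s in nhds t, c s ∈ manifold (p + 1) p) (hc : HasDerivAt c ξ t) :
    HasDerivAt (fun s => rotation X (c s)) (momentum (c t) ξ * rotation X (c t)) t := by
  refine ((hasDerivAt_matrix_mul hc (hasDerivAt_const t Xᵀ)).add (hasDerivAt_matrix_mul
    (hasDerivAt_normal hmem hc) (hasDerivAt_const t (normal X)ᵀ))).congr_deriv ?_
  rw [rotation, Matrix.mul_add, ← Matrix.mul_assoc, ← Matrix.mul_assoc,
    momentum_mul hmem.self_of_nhds, Matrix.mul_zero, Matrix.mul_zero, add_zero, add_zero]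

theorem IsGeodesic.dotProduct_rotation_eq_cos {γ : ℝ → Matrix (Fin (p + 1)) (Fin p) ℝ}
    (hγ : IsGeodesic (1 / 2) γ) {u : Fin (p + 1) → ℝ} (hu : u ⬝ᵥ u = 1) {μ : ℝ}
    (hμ : ((momentum (γ 0) (deriv γ 0))ᵀ * momentum (γ 0) (deriv γ 0)) *ᵥ u = μ ^ 2 • u) (t : ℝ) :
    u ⬝ᵥ (rotation (γ 0) (γ t) *ᵥ u) = Real.cos (μ * t) := by
  have hskew := momentum_skew (hγ.deriv_mem 0)
  set B := momentum (γ 0) (deriv γ 0) with hB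
  have hx0 : rotation (γ 0) (γ 0) *ᵥ u = u := by
    rw [rotation, mul_transpose_add_normal (hγ.2.1 0), Matrix.one_mulVec]
  have hflow (t : ℝ) : HasDerivAt (fun s => rotation (γ 0) (γ s) *ᵥ u)
      (B *ᵥ (rotation (γ 0) (γ t) *ᵥ u)) t := by
    rw [hB, hγ.momentum_eq 0 t, Matrix.mulVec_mulVec]
    exact hasDerivAt_mulVec (hasDerivAt_rotation _ (.of_forall hγ.2.1) (hγ.hasDerivAt t)) u
  have hBB : B *ᵥ (B *ᵥ u) = -(μ ^ 2 • u) := by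
    rw [← hμ, hskew, Matrix.neg_mul, Matrix.neg_mulVec, neg_neg, Matrix.mulVec_mulVec]
  simpa only [hx0] using dotProduct_eq_cos_of_hasDerivAt_mulVec hskew hflow
    (by rw [hx0, hu]) (by rw [hx0, hBB]) t

end Rotation

section SingularValues

variable {ι : Type*} [Fintype ι]

-- The nonzero singular values of a skew-symmetric matrix come in pairs.
theorem two_mul_mulVec_dotProduct_mulVec_le_trace {M : Matrix ι ι ℝ} (hM : Mᵀ = -M) {u : ι → ℝ}
    (hu : u ⬝ᵥ u = 1) : 2 * ((M *ᵥ u) ⬝ᵥ (M *ᵥ u)) ≤ (Mᵀ * M).trace := by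
  set y := M *ᵥ u with hy
  have huy : u ⬝ᵥ y = 0 := dotProduct_mulVec_skew_self hM u
  have hyu : y ⬝ᵥ u = 0 := by rw [dotProduct_comm, huy]
  have hMy : (M *ᵥ y) ⬝ᵥ u = -(y ⬝ᵥ y) := by rw [dotProduct_comm, dotProduct_mulVec_skew hM]
  set K := Matrix.vecMulVec y u - Matrix.vecMulVec u y with hK
  have hKskew : Kᵀ = -K := by
    rw [hK, Matrix.transpose_sub, Matrix.transpose_vecMulVec, Matrix.transpose_vecMulVec, neg_sub]
  have hMK : (M * K).trace = -2 * (y ⬝ᵥ y) := by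
    rw [hK, Matrix.mul_sub, Matrix.mul_vecMulVec, Matrix.mul_vecMulVec, Matrix.trace_sub,
      Matrix.trace_vecMulVec, Matrix.trace_vecMulVec, hMy, ← hy]
    ring
  have hKK : (K * K).trace = -2 * (y ⬝ᵥ y) := by
    rw [hK]
    simp only [Matrix.sub_mul, Matrix.mul_sub, Matrix.vecMulVec_mul_vecMulVec, Matrix.trace_sub,
      Matrix.trace_vecMulVec, dotProduct_smul, hu, huy, hyu, smul_eq_mul]
    ring
  have hnonneg : 0 ≤ ((M - K)ᵀ * (M - K)).trace := by
    simpa using (Matrix.posSemidef_conjTranspose_mul_self (M - K)).trace_nonneg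
  rw [Matrix.transpose_sub, hM, hKskew] at hnonneg
  simp only [Matrix.sub_mul, Matrix.mul_sub, Matrix.neg_mul, Matrix.trace_sub, Matrix.trace_neg,
    Matrix.trace_mul_comm K M, hMK, hKK] at hnonneg
  rw [hM, Matrix.neg_mul, Matrix.trace_neg]
  linarith

variable [DecidableEq ι]

theorem exists_orthogonal_singularValues (M : Matrix ι ι ℝ) :
    ∃ (U : Matrix ι ι ℝ) (σ : ι → ℝ), Uᵀ * U = 1 ∧ (∀ j, 0 ≤ σ j) ∧
      ∀ j, (Mᵀ * M) *ᵥ U.col j = σ j ^ 2 • U.col j := by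
  have hpos : (Mᵀ * M).PosSemidef := by
    simpa using Matrix.posSemidef_conjTranspose_mul_self M
  refine ⟨hpos.1.eigenvectorUnitary.1, fun j => √(hpos.1.eigenvalues j), ?_,
    fun j => Real.sqrt_nonneg _, fun j => ?_⟩
  · simpa [Matrix.star_eq_conjTranspose] using
      Matrix.mem_unitaryGroup_iff'.1 hpos.1.eigenvectorUnitary.2
  · rw [Real.sq_sqrt (hpos.eigenvalues_nonneg j)]
    exact hpos.1.mulVec_eigenvectorBasis j

theorem col_dotProduct_col_self {U : Matrix ι ι ℝ} (hU : Uᵀ * U = 1) (j : ι) :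
    U.col j ⬝ᵥ U.col j = 1 :=
  (congrFun (congrFun hU j) j).trans (Matrix.one_apply_eq j)

theorem sum_mulVec_col_dotProduct_mulVec_col {U : Matrix ι ι ℝ} (hU : Uᵀ * U = 1)
    (B : Matrix ι ι ℝ) : ∑ j, (B *ᵥ U.col j) ⬝ᵥ (B *ᵥ U.col j) = (Bᵀ * B).trace := by
  change ((B * U)ᵀ * (B * U)).trace = _
  rw [Matrix.transpose_mul, Matrix.mul_assoc, Matrix.trace_mul_comm, Matrix.mul_assoc,
    Matrix.mul_assoc, mul_eq_one_comm.1 hU, Matrix.mul_one]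

theorem sum_mul_sqrt_mulVec_col_le {U : Matrix ι ι ℝ} (hU : Uᵀ * U = 1) (B : Matrix ι ι ℝ)
    (a : ι → ℝ) :
    ∑ j, a j * √((B *ᵥ U.col j) ⬝ᵥ (B *ᵥ U.col j)) ≤ √((∑ j, a j ^ 2) * (Bᵀ * B).trace) := by
  have hsq (j : ι) : √((B *ᵥ U.col j) ⬝ᵥ (B *ᵥ U.col j)) ^ 2 = (B *ᵥ U.col j) ⬝ᵥ (B *ᵥ U.col j) :=
    Real.sq_sqrt (Finset.sum_nonneg fun _ _ => mul_self_nonneg _)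
  rw [Real.sqrt_mul (Finset.sum_nonneg fun j _ => sq_nonneg (a j)),
    ← sum_mulVec_col_dotProduct_mulVec_col hU]
  simpa only [hsq] using Real.sum_mul_le_sqrt_mul_sqrt Finset.univ a
    fun j => √((B *ᵥ U.col j) ⬝ᵥ (B *ᵥ U.col j))

end SingularValues

section Hyperplane

variable {p : ℕ}

theorem sum_mul_arccos_rotation_sub_le_curveLength {X : Matrix (Fin (p + 1)) (Fin p) ℝ}
    (hX : X ∈ manifold (p + 1) p) {c : ℝ → Matrix (Fin (p + 1)) (Fin p) ℝ}
    (hc : IsPiecewiseC1Curve c) {U : Matrix (Fin (p + 1)) (Fin (p + 1)) ℝ} (hU : Uᵀ * U = 1)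
    {a : Fin (p + 1) → ℝ} (ha : ∀ j, 0 ≤ a j) (hsum : ∑ j, a j ^ 2 = 1 / 2) :
    ∑ j, a j * Real.arccos (U.col j ⬝ᵥ (rotation X (c 1) *ᵥ U.col j)) -
      ∑ j, a j * Real.arccos (U.col j ⬝ᵥ (rotation X (c 0) *ᵥ U.col j)) ≤
        curveLength (1 / 2) c := by
  have hcol := col_dotProduct_col_self hU
  refine sum_mul_arccos_sub_le_curveLength hc ha hcol (x := fun j s => rotation X (c s) *ᵥ U.col j)
    (fun j => ((continuous_rotation X).matrix_mulVec continuous_const).comp_continuousOn hc.1)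
    (fun j s hs => (mulVec_dotProduct_self (rotation_orthogonal hX (hc.2.1 s hs)) _).trans (hcol j))
    fun t ht ξ hξ => ?_
  have hmem := Filter.eventually_of_mem (Icc_mem_nhds ht.1 ht.2) hc.2.1
  have hrotation := rotation_orthogonal hX hmem.self_of_nhds
  set B := momentum (c t) ξ
  set R := rotation X (c t)
  have htrace : ((B * R)ᵀ * (B * R)).trace = 2 * metric (1 / 2) (c t) ξ ξ := by
    rw [Matrix.transpose_mul, Matrix.mul_assoc, Matrix.trace_mul_comm, Matrix.mul_assoc,
      Matrix.mul_assoc, mul_eq_one_comm.1 hrotation, Matrix.mul_one,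
      trace_momentum_transpose_mul_self hmem.self_of_nhds (deriv_mem_tangentSpace hmem hξ)]
  refine ⟨fun j => (B * R) *ᵥ U.col j,
    fun j => hasDerivAt_mulVec (hasDerivAt_rotation X hmem hξ) _, ?_⟩
  calc ∑ j, a j * √(((B * R) *ᵥ U.col j) ⬝ᵥ ((B * R) *ᵥ U.col j))
      ≤ √((∑ j, a j ^ 2) * ((B * R)ᵀ * (B * R)).trace) := sum_mul_sqrt_mulVec_col_le hU _ a
    _ = √(metric (1 / 2) (c t) ξ ξ) := by
      rw [hsum, htrace]
      congr 1
      ring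

/-- The momentum of a unit-speed geodesic has singular values `σ j ≤ 1`, so that up to time `π` it
rotates the `j`-th singular vector monotonically away from itself, by the angle `t * σ j`. The sum
of these angles with the weights `σ j / 2` is therefore `t`, and it bounds the distance from
below. -/
theorem pi_le_injRadius_hyperplane (p : ℕ) :
    ENNReal.ofReal Real.pi ≤ injRadius (1 / 2) (p + 1) p := by
  refine le_injRadius fun γ hγ hunit => le_cutTime hγ.contDiff_one hγ.2.1
    (speed_eq_one_of_metric_eq_one hunit) Real.pi_pos fun c hc hc0 hc1 => ?_
  have htrace := trace_momentum_transpose_mul_self (hγ.2.1 0) (hγ.deriv_mem 0)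
  have hskew := momentum_skew (hγ.deriv_mem 0)
  rw [hunit, mul_one] at htrace
  obtain ⟨U, σ, hU, hσ0, heigen⟩ :=
    exists_orthogonal_singularValues (momentum (γ 0) (deriv γ 0))
  have hcol := col_dotProduct_col_self hU
  have hcos (j : Fin (p + 1)) := hγ.dotProduct_rotation_eq_cos (hcol j) (heigen j)
  set M := momentum (γ 0) (deriv γ 0)
  have hnorm (j : Fin (p + 1)) : (M *ᵥ U.col j) ⬝ᵥ (M *ᵥ U.col j) = σ j ^ 2 := by
    rw [mulVec_dotProduct_mulVec, heigen, dotProduct_smul, hcol, smul_eq_mul, mul_one]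
  have hσ1 (j : Fin (p + 1)) : σ j ≤ 1 := by
    have := two_mul_mulVec_dotProduct_mulVec_le_trace hskew (hcol j)
    rw [hnorm, htrace] at this
    nlinarith
  have hσsum : ∑ j, σ j ^ 2 = 2 := by
    simpa only [hnorm, htrace] using sum_mulVec_col_dotProduct_mulVec_col hU M
  have h := sum_mul_arccos_rotation_sub_le_curveLength (hγ.2.1 0) hc hU (a := fun j => σ j / 2)
    (fun j => div_nonneg (hσ0 j) zero_le_two)
    (by simp only [div_pow, ← Finset.sum_div, hσsum]; norm_num)
  have hangle (j : Fin (p + 1)) : Real.arccos (Real.cos (σ j * Real.pi)) = σ j * Real.pi :=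
    Real.arccos_cos (mul_nonneg (hσ0 j) Real.pi_pos.le) (by nlinarith [hσ1 j, Real.pi_pos])
  simp only [hc0, hc1, hcos, hangle, mul_zero, Real.cos_zero, Real.arccos_one,
    Finset.sum_const_zero, sub_zero] at h
  calc Real.pi = (∑ j, σ j ^ 2) * (Real.pi / 2) := by rw [hσsum]; ring
    _ = ∑ j, σ j / 2 * (σ j * Real.pi) := by
      rw [Finset.sum_mul]
      exact Finset.sum_congr rfl fun j _ => by ring
    _ ≤ curveLength (1 / 2) c := h

end Hyperplane

end Stiefel

end

theorem corollary7p2 :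
    (∃ tr : ℝ, IsLeast {t : ℝ | 0 < t ∧ Real.sin t / t + Real.cos t = 0} tr ∧
      |tr * √2 / Real.pi - 0.91326189159122| ≤ 5 / 10 ^ 15 ∧
      ∀ n p : ℕ, 2 ≤ p → p + 2 ≤ n →
        Stiefel.injRadius (1 / 2) n p ≤ ENNReal.ofReal (tr * √2)) ∧
    (∀ n p : ℕ, 2 ≤ p → p + 2 ≤ n → Stiefel.injRadius 1 n p ≤ ENNReal.ofReal Real.pi) ∧
    (∀ n p : ℕ, 1 ≤ p → n = p + 1 →
      Stiefel.injRadius (1 / 2) n p = ENNReal.ofReal Real.pi ∧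
      Stiefel.injRadius 1 n p ≤ ENNReal.ofReal Real.pi) ∧
    (∀ β : ℝ, 0 < β → ∀ n : ℕ, 2 ≤ n →
      Stiefel.injRadius β n 1 = ENNReal.ofReal Real.pi) := by
  refine ⟨?_, fun n p hp hn => Stiefel.injRadius_le_pi (by omega) (by omega) 1, ?_,
    fun β _ n hn => le_antisymm (Stiefel.injRadius_le_pi le_rfl hn β)
      (Stiefel.pi_le_injRadius_sphere n β)⟩
  · obtain ⟨τ, hτ, hzero⟩ := Stiefel.exists_sinAddMulCos_eq_zero
    have hτπ : τ ∈ Set.Icc (Real.pi / 2) Real.pi :=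
      ⟨by linarith [hτ.1, Real.pi_lt_d2], by linarith [hτ.2, Real.pi_gt_three]⟩
    exact ⟨τ, Stiefel.isLeast_of_sinAddMulCos_eq_zero hτπ hzero,
      Stiefel.abs_mul_sqrt_two_div_pi_sub_le hτ,
      fun n p hp hn => Stiefel.injRadius_canonical_le hp hn hτπ hzero⟩
  · rintro n p hp rfl
    exact ⟨le_antisymm (Stiefel.injRadius_le_pi hp le_rfl _) (Stiefel.pi_le_injRadius_hyperplane p),
      Stiefel.injRadius_le_pi hp le_rfl 1⟩
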